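/- **Setting.** Let $A\in\mathbb R^{n\times n}$, $B\in\mathbb R^{n\times m}$, saturation levels $\bar u\in\mathbb R^m_{>0}$, and let the plant state be split as $x_p=(x_p^{(1)},\dots,x_p^{(q)})$ with $x_p^{(i)}\in\mathbb R^{n_i}$, $\sum_i n_i=n$. Let $0<T_1^{(i)}\le T_2^{(i)}$ for $i=1,\dots,q$, $\mathcal T=\prod_{i=1}^q[0,T_2^{(i)}]$, $\mathrm{sat}_{\bar u}(v)_i=\min(|v_i|,\bar u_i)\,\mathrm{sign}(v_i)$ and $\mathrm{dz}_{\bar u}(v)=\mathrm{sat}_{\bar u}(v)-v$. For $K\in\mathbb R^{m\times n}$ consider the hybrid system with state $x=(\bar x,\tau)$, $\bar x=(x_p,\tilde\eta)\in\mathbb R^{2n}$, $\tau\in\mathbb R^q$: $$\dot{\bar x}=\begin{bmatrix}A+BK&-BK\\0&A\end{bmatrix}\bar x+\begin{bmatrix}B\\0\end{bmatrix}\mathrm{dz}_{\bar u}\big(K x_p-K\tilde\eta\big),\qquad \dot\tau=-(1,\dots,1),\qquad x\in\mathcal C:=\mathbb R^{2n}\times\mathcal T,$$ and, when $\tau\in\mathcal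 T$ and $\tau_i=0$ for some $i$, a jump that for one such $i$ sets $\tilde\eta^{(i)}$ to $0$, resets $\tau_i$ to an arbitrary point of $[T_1^{(i)},T_2^{(i)}]$, and leaves $x_p$ and the other components of $\tilde\eta$ and $\tau$ unchanged. Solutions are hybrid arcs on hybrid time domains in the sense of Goebel, Sanfelice and Teel. Let $\mathcal A=\{0\}\times\mathcal T$, and let $|x|_{\mathcal A}$ be the Euclidean distance of $x$ to $\mathcal A$. The set $\mathcal A$ is *exponentially stable* if there are $\kappa,\lambda,\mu>0$ such that every maximal solution $\phi$ with $|\phi(0,0)|_{\mathcal A}\le\mu$ is complete and satisfies $|\phi(t,j)|_{\mathcal A}\le\kappa e^{-\lambda(t+j)}|\phi(0,0)|_{\mathcal A}$ for all $(t,j)\in\operatorname{dom}\phi$. The *basin of attraction* of $\mathcal A$ is the set of points from which every maximal solution is complete and converges to $\mathcal A$. **Proposition.** Let $W\in\mathbb R^{n\times n}$ and $R_i\in\mathbb R^{n_i\times n_i}$ ($i=1,\dots,q$) be symmetric positive definite, $S\in\mathbb R^{m\times m}$ diagonal positive definite, $Y,Z\in\mathbb R^{m\times n}$, and $\sigma_1,\dots,\sigma_q,\bar\mu,\alpha>0$.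 Put $\widehat R=\bigoplus_i R_i$, $\Sigma=\bigoplus_i\sigma_i\mathbf I_{n_i}$, $\operatorname{He}(M)=M+M^{\mathsf T}$ and $\mathcal Z=\{\bigoplus_i\psi_i\mathbf I_{n_i}:\psi_i\in\{1,e^{\sigma_iT_2^{(i)}}\}\}$, and let $Z_{(i)}$ be the $i$-th row of $Z$. Suppose that $$\begin{bmatrix}W&0&Z_{(i)}^{\mathsf T}\\ \star&\widehat R&0\\ \star&\star&\bar u_i^2/\bar\mu\end{bmatrix}\succeq0\qquad\forall i\in\{1,\dots,m\}$$ and that for all $\Psi\in\mathcal Z$ $$\begin{bmatrix}\operatorname{He}(AW+BY)&-BY&BS-Y^{\mathsf T}-Z^{\mathsf T}&0\\ \star&-2\alpha W&Y^{\mathsf T}&\alpha\mathbf I\\ \star&\star&-2S&0\\ \star&\star&\star&\operatorname{He}(\widehat R\Psi A)-\Sigma\widehat R\Psi\end{bmatrix}\prec0 .$$ Then, for $K=YW^{-1}$, the set $\mathcal A$ is exponentially stable for the hybrid system, and the set $$\mathcal Q_{\bar\mu}=\Big\{(\bar x,\tau)\in\mathcal C:\ \bar x^{\mathsf T}\Big(W^{-1}\oplus\bigoplus_{i=1}^q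 e^{\sigma_i\tau_i}R_i\Big)\bar x\le\bar\mu\Big\}$$ is contained in the basin of attraction of $\mathcal A$. -/

import Mathlib

open Set Matrix

noncomputable section

namespace MultiRateSat

/-! ### Hybrid systems -/

/-- A hybrid system `ẋ = f(x)` for `x ∈ C`, `x⁺ ∈ G(x)` for `x ∈ D`. -/
structure HybridSystem (E : Type*) where
  /-- flow map -/
  f : E → E
  /-- flow set -/
  C : Set E
  /-- jump map (set valued) -/
  G : E → Set E
  /-- jump set -/
  D : Set E

/-- A hybrid time domain is the union of a finite or infinite sequence of intervals
`[t_j, t_{j+1}] × {j}`, with `0 = t_0 ≤ t_1 ≤ …`, where the last interval, if there is one,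
is possibly of the form `[t_J, T)` with `T` finite or `T = ∞`. -/
def IsHybridTimeDomain (E : Set (ℝ × ℕ)) : Prop :=
  ∃ t : ℕ → ℝ, t 0 = 0 ∧ Monotone t ∧
    (E = {p | p.1 ∈ Icc (t p.2) (t (p.2 + 1))} ∨
      (∃ J : ℕ, E = {p | p.2 ≤ J ∧ p.1 ∈ Icc (t p.2) (t (p.2 + 1))}) ∨
      (∃ (J : ℕ) (T : ℝ), t J < T ∧
        E = {p | p.2 < J ∧ p.1 ∈ Icc (t p.2) (t (p.2 + 1))} ∪ {p | p.2 = J ∧ p.1 ∈ Ico (t J) T}) ∨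
      (∃ J : ℕ,
        E = {p | p.2 < J ∧ p.1 ∈ Icc (t p.2) (t (p.2 + 1))} ∪ {p | p.2 = J ∧ p.1 ∈ Ici (t J)}))

/-- A hybrid arc. Only the values of `toFun` on `dom` are meaningful. -/
structure HybridArc (E : Type*) [PseudoMetricSpace E] where
  /-- the domain -/
  dom : Set (ℝ × ℕ)
  /-- the values -/
  toFun : ℝ → ℕ → E
  isHybridTimeDomain : IsHybridTimeDomain dom
  /-- `φ(·, j)` is locally absolutely continuous on `{t | (t, j) ∈ dom φ}` -/
  locallyAbsolutelyContinuous : ∀ (j : ℕ) (a b : ℝ), a ≤ b → (a, j) ∈ dom → (b, j) ∈ dom →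
    AbsolutelyContinuousOnInterval (fun t => toFun t j) a b

section
variable {E : Type*} [NormedAddCommGroup E] [NormedSpace ℝ E]

/-- The interval of flow `{t | (t, j) ∈ dom φ}` between the jumps `j` and `j + 1`. -/
def HybridArc.flowInterval (φ : HybridArc E) (j : ℕ) : Set ℝ := {t | (t, j) ∈ φ.dom}

/-- `φ` is a solution of the hybrid system `H`. -/
structure IsSolution (H : HybridSystem E) (φ : HybridArc E) : Prop where
  initial : φ.toFun 0 0 ∈ closure H.C ∪ H.D
  flow_mem : ∀ j : ℕ, ∀ t ∈ interior (φ.flowInterval j), φ.toFun t j ∈ H.C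
  flow_deriv : ∀ j : ℕ, ∀ᵐ t : ℝ, t ∈ interior (φ.flowInterval j) →
    HasDerivAt (fun s => φ.toFun s j) (H.f (φ.toFun t j)) t
  jump : ∀ (t : ℝ) (j : ℕ), (t, j) ∈ φ.dom → (t, j + 1) ∈ φ.dom →
    φ.toFun t j ∈ H.D ∧ φ.toFun t (j + 1) ∈ H.G (φ.toFun t j)

/-- `φ` is a solution that cannot be extended to a solution with a strictly larger domain. -/
def IsMaximalSolution (H : HybridSystem E) (φ : HybridArc E) : Prop :=
  IsSolution H φ ∧ ¬ ∃ ψ : HybridArc E, IsSolution H ψ ∧ φ.dom ⊂ ψ.dom ∧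
    ∀ (t : ℝ) (j : ℕ), (t, j) ∈ φ.dom → ψ.toFun t j = φ.toFun t j

/-- A hybrid arc is complete if its domain is unbounded. -/
def IsComplete (φ : HybridArc E) : Prop := ¬ Bornology.IsBounded φ.dom

/-- `φ` converges to the set `𝒜`: its distance to `𝒜` tends to `0` as `t + j → ∞`. -/
def ConvergesTo (φ : HybridArc E) (𝒜 : Set E) : Prop :=
  ∀ ε > 0, ∃ N : ℝ, ∀ (t : ℝ) (j : ℕ), (t, j) ∈ φ.dom → N ≤ t + j →
    Metric.infDist (φ.toFun t j) 𝒜 < ε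

/-- Exponential stability of the set `𝒜` for the hybrid system `H`. -/
def ExponentiallyStable (H : HybridSystem E) (𝒜 : Set E) : Prop :=
  ∃ κ lam μ : ℝ, 0 < κ ∧ 0 < lam ∧ 0 < μ ∧
    ∀ φ : HybridArc E, IsMaximalSolution H φ → Metric.infDist (φ.toFun 0 0) 𝒜 ≤ μ →
      IsComplete φ ∧ ∀ (t : ℝ) (j : ℕ), (t, j) ∈ φ.dom →
        Metric.infDist (φ.toFun t j) 𝒜 ≤
          κ * Real.exp (-lam * (t + j)) * Metric.infDist (φ.toFun 0 0) 𝒜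

/-- The basin of attraction of `𝒜`: the points all of whose maximal solutions are complete and
converge to `𝒜`. -/
def basin (H : HybridSystem E) (𝒜 : Set E) : Set E :=
  {ξ | ∀ φ : HybridArc E, IsMaximalSolution H φ → φ.toFun 0 0 = ξ →
    IsComplete φ ∧ ConvergesTo φ 𝒜}

end

/-! ### The closed loop -/

/-- Symmetric decentralized saturation with levels `ubar`. -/
def sat {m : ℕ} (ubar v : Fin m → ℝ) : Fin m → ℝ :=
  fun i => min |v i| (ubar i) * Real.sign (v i)

/-- Decentralized deadzone. -/
def dz {m : ℕ} (ubar v : Fin m → ℝ) : Fin m → ℝ := sat ubar v - v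

/-- Indices of the coordinates of the plant state, made of `q` clusters of sizes `n i`. -/
abbrev PlantIdx {q : ℕ} (n : Fin q → ℕ) : Type := (i : Fin q) × Fin (n i)

/-- The state space of the closed loop: the plant state, the estimation error, the timers;
with the Euclidean norm. -/
abbrev State {q : ℕ} (n : Fin q → ℕ) : Type :=
  EuclideanSpace ℝ ((PlantIdx n ⊕ PlantIdx n) ⊕ Fin q)

section
variable {q m : ℕ} {n : Fin q → ℕ}

/-- The component `x̄ = (x_p, η̃)` of the state. -/
def State.bar (x : State n) : PlantIdx n ⊕ PlantIdx n → ℝ := fun k => x (Sum.inl k)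

/-- The plant state `x_p`. -/
def State.plant (x : State n) : PlantIdx n → ℝ := fun k => x (Sum.inl (Sum.inl k))

/-- The estimation error `η̃`. -/
def State.err (x : State n) : PlantIdx n → ℝ := fun k => x (Sum.inl (Sum.inr k))

/-- The timers `τ`. -/
def State.timer (x : State n) : Fin q → ℝ := fun i => x (Sum.inr i)

/-- The set `∏ [0, T₂⁽ⁱ⁾]` of timer values. -/
def timerSet (T₂ : Fin q → ℝ) : Set (Fin q → ℝ) := {τ | ∀ i, τ i ∈ Icc 0 (T₂ i)}

/-- The timer values at which timer `i` has expired. -/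
def expired (T₂ : Fin q → ℝ) (i : Fin q) : Set (Fin q → ℝ) := {τ ∈ timerSet T₂ | τ i = 0}

/-- The values to which `τ` may be reset when timer `i` expires. -/
def timerReset (T₁ T₂ : Fin q → ℝ) (i : Fin q) (τ : Fin q → ℝ) : Set (Fin q → ℝ) :=
  {χ | χ i ∈ Icc (T₁ i) (T₂ i) ∧ ∀ k, k ≠ i → χ k = τ k}

/-- The map that sets the `i`-th cluster of the error to zero. -/
def resetErr (i : Fin q) (η : PlantIdx n → ℝ) : PlantIdx n → ℝ :=
  blockDiagonal' (fun j => if j = i then (0 : Matrix (Fin (n j)) (Fin (n j)) ℝ) else 1) *ᵥ η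

/-- The matrix `[A + BK, -BK; 0, A]`. -/
def Acl (A : Matrix (PlantIdx n) (PlantIdx n) ℝ) (B : Matrix (PlantIdx n) (Fin m) ℝ)
    (K : Matrix (Fin m) (PlantIdx n) ℝ) :
    Matrix (PlantIdx n ⊕ PlantIdx n) (PlantIdx n ⊕ PlantIdx n) ℝ :=
  fromBlocks (A + B * K) (-(B * K)) 0 A

/-- The matrix `[B; 0]`. -/
def Bcl (B : Matrix (PlantIdx n) (Fin m) ℝ) : Matrix (PlantIdx n ⊕ PlantIdx n) (Fin m) ℝ :=
  fromRows B 0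

/-- The matrix `[K, -K]`. -/
def Kcl (K : Matrix (Fin m) (PlantIdx n) ℝ) : Matrix (Fin m) (PlantIdx n ⊕ PlantIdx n) ℝ :=
  fromCols K (-K)

/-- The closed-loop hybrid system. -/
def closedLoop (A : Matrix (PlantIdx n) (PlantIdx n) ℝ) (B : Matrix (PlantIdx n) (Fin m) ℝ)
    (ubar : Fin m → ℝ) (T₁ T₂ : Fin q → ℝ) (K : Matrix (Fin m) (PlantIdx n) ℝ) :
    HybridSystem (State n) where
  f x := WithLp.toLp 2 (Sum.elim
    (Acl A B K *ᵥ x.bar + Bcl B *ᵥ dz ubar (Kcl K *ᵥ x.bar)) (fun _ => -1))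
  C := {x | x.timer ∈ timerSet T₂}
  G x := {g | g.plant = x.plant ∧
    ∃ i, x.timer ∈ expired T₂ i ∧ g.err = resetErr i x.err ∧ g.timer ∈ timerReset T₁ T₂ i x.timer}
  D := {x | ∃ i, x.timer ∈ expired T₂ i}

/-- The set `{0} × ∏ [0, T₂⁽ⁱ⁾]`. -/
def attractor (n : Fin q → ℕ) (T₂ : Fin q → ℝ) : Set (State n) :=
  {x | x.bar = 0 ∧ x.timer ∈ timerSet T₂}

/-! ### The matrix inequalities -/

/-- `He(M) = M + Mᵀ`. -/
def He {ι : Type*} (M : Matrix ι ι ℝ) : Matrix ι ι ℝ := M + Mᵀ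

/-- The direct sum `⊕ c_i I_{n_i}`. -/
def scalarBlocks (n : Fin q → ℕ) (c : Fin q → ℝ) : Matrix (PlantIdx n) (PlantIdx n) ℝ :=
  blockDiagonal' (fun i => c i • (1 : Matrix (Fin (n i)) (Fin (n i)) ℝ))

/-- The finite set of vertices `⊕ ψ_i I_{n_i}` with `ψ_i ∈ {1, exp (σ_i T₂⁽ⁱ⁾)}`. -/
def vertices (n : Fin q → ℕ) (σ T₂ : Fin q → ℝ) : Set (Matrix (PlantIdx n) (PlantIdx n) ℝ) :=
  {Ψ | ∃ ψ : Fin q → ℝ, (∀ i, ψ i ∈ ({1, Real.exp (σ i * T₂ i)} : Set ℝ)) ∧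
    Ψ = scalarBlocks n ψ}

/-- The matrix `W⁻¹ ⊕ R(τ)` with `R(τ) = ⊕ exp (σ_i τ_i) R_i`. -/
def Phat (W : Matrix (PlantIdx n) (PlantIdx n) ℝ)
    (R : (i : Fin q) → Matrix (Fin (n i)) (Fin (n i)) ℝ) (σ τ : Fin q → ℝ) :
    Matrix (PlantIdx n ⊕ PlantIdx n) (PlantIdx n ⊕ PlantIdx n) ℝ :=
  fromBlocks W⁻¹ 0 0 (blockDiagonal' (fun i => Real.exp (σ i * τ i) • R i))

/-- The set `{(x̄, τ) : τ ∈ ∏ [0, T₂⁽ⁱ⁾], x̄ᵀ (W⁻¹ ⊕ R(τ)) x̄ ≤ μ}`. -/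
def basinEstimate (T₂ : Fin q → ℝ) (W : Matrix (PlantIdx n) (PlantIdx n) ℝ)
    (R : (i : Fin q) → Matrix (Fin (n i)) (Fin (n i)) ℝ) (σ : Fin q → ℝ) (μ : ℝ) :
    Set (State n) :=
  {x | x.timer ∈ timerSet T₂ ∧ x.bar ⬝ᵥ (Phat W R σ x.timer *ᵥ x.bar) ≤ μ}

/-- The matrix `[W, 0, zᵀ; 0, R, 0; z, 0, c]`, where `z` is a row. -/
def inclusionMatrix (W Rhat : Matrix (PlantIdx n) (PlantIdx n) ℝ) (z : PlantIdx n → ℝ) (c : ℝ) :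
    Matrix ((PlantIdx n ⊕ PlantIdx n) ⊕ Unit) ((PlantIdx n ⊕ PlantIdx n) ⊕ Unit) ℝ :=
  fromBlocks (fromBlocks W 0 0 Rhat)
    (replicateCol Unit (Sum.elim z 0)) (replicateRow Unit (Sum.elim z 0)) (of fun _ _ => c)

/-- The symmetric matrix with upper block-triangular part
`[He(AW + BY), -BY, BS - Yᵀ - Zᵀ, 0; ⋆, -2αW, Yᵀ, αI; ⋆, ⋆, -2S, 0; ⋆, ⋆, ⋆, He(RΨA) - ΣRΨ]`. -/
def designMatrix (A : Matrix (PlantIdx n) (PlantIdx n) ℝ) (B : Matrix (PlantIdx n) (Fin m) ℝ)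
    (W Rhat Sig Ψ : Matrix (PlantIdx n) (PlantIdx n) ℝ) (Y Z : Matrix (Fin m) (PlantIdx n) ℝ)
    (S : Matrix (Fin m) (Fin m) ℝ) (α : ℝ) :
    Matrix ((PlantIdx n ⊕ PlantIdx n) ⊕ (Fin m ⊕ PlantIdx n))
      ((PlantIdx n ⊕ PlantIdx n) ⊕ (Fin m ⊕ PlantIdx n)) ℝ :=
  let M₁₁ := fromBlocks (He (A * W + B * Y)) (-(B * Y)) (-(B * Y))ᵀ (-((2 * α) • W))
  let M₁₂ := fromBlocks (B * S - Yᵀ - Zᵀ) 0 Yᵀ (α • (1 : Matrix (PlantIdx n) (PlantIdx n) ℝ))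
  let M₂₂ := fromBlocks (-((2 : ℝ) • S)) 0 0 (He (Rhat * Ψ * A) - Sig * Rhat * Ψ)
  fromBlocks M₁₁ M₁₂ M₁₂ᵀ M₂₂

end

end MultiRateSat

end

open MultiRateSat

/-!
The function `V(x) = x_pᵀ W⁻¹ x_p + ∑ exp (σ_i τ_i) η̃_iᵀ R_i η̃_i` is a Lyapunov function for the
closed loop on the sublevel set `V ≤ μbar`; it is comparable to the squared distance to the
attractor (`exists_lyapunov_bounds`, `infDist_attractor`).

*Flow.* Put `ξ = W⁻¹ x_p`, `v = W⁻¹ η̃` and `s = S⁻¹ dz(u)` with `u = K (x_p - η̃)`. The derivative of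
`V` along the flow is the value at `(ξ, v, s, η̃)` of the quadratic form of the design matrix with
`ψ_i = exp (σ_i τ_i)`, plus `2 sᵀ (dz(u) + u + Z ξ)`; the terms in `α` cancel. The last summand is
nonpositive by the sector condition `dz_mul_add_nonpos`, because the inclusion inequality gives
`|(Z ξ)_i| ≤ ubar_i` where `V ≤ μbar`. The design matrix is affine in `ψ`, so its form is bounded by
its value at a vertex of the box in which `ψ` lives; there it is negative definite. This yields
`V' ≤ -c V` (`exists_lyapunov_decay`), and in particular solutions cannot leave `V ≤ μbar`.

*Jumps.* A jump replaces one summand of `V` by zero. The quantity `∑ (τ_i + t) / T₁⁽ⁱ⁾` is constant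
during flow and increases by at least one at each jump, so that `j` is at most affine in `t` and
exponential decay in `t` is exponential decay in `t + j` (`IsSolution.invariants`).

*Completeness.* A maximal solution with bounded velocity is complete if at each of its points it can
jump or flow on (`IsMaximalSolution.isComplete`): its domain can be closed because the solution is
Lipschitz, and it can be continued from there by a jump or by the Picard–Lindelöf theorem.
-/

namespace MultiRateSat

open MeasureTheory Filter Topology

/-! ### Absolutely continuous solutions of differential equations -/

section Curves

variable {E : Type*} [NormedAddCommGroup E] [NormedSpace ℝ E] {f : E → E} {z : ℝ → E} {a b : ℝ}

theorem exists_lipschitzOnWith_of_hasDerivWithinAt {v : ℝ → E} {s : Set ℝ} (hs : Convex ℝ s)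
    {M : ℝ} (hz : ∀ t ∈ s, HasDerivWithinAt z (v t) s t) (hM : ∀ t ∈ s, ‖v t‖ ≤ M) :
    ∃ C : NNReal, LipschitzOnWith C z s := by
  refine ⟨M.toNNReal, hs.lipschitzOnWith_of_nnnorm_hasDerivWithin_le hz fun t ht => ?_⟩
  rw [← NNReal.coe_le_coe, coe_nnnorm]
  exact (hM t ht).trans (Real.le_coe_toNNReal M)

theorem absolutelyContinuousOnInterval_of_hasDerivWithinAt {v : ℝ → E} (hab : a ≤ b)
    (hv : ContinuousOn v (Icc a b))
    (hz : ∀ t ∈ Icc a b, HasDerivWithinAt z (v t) (Icc a b) t) :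
    AbsolutelyContinuousOnInterval z a b := by
  obtain ⟨M, hM⟩ := isCompact_Icc.exists_bound_of_continuousOn hv
  obtain ⟨C, hC⟩ := exists_lipschitzOnWith_of_hasDerivWithinAt (convex_Icc a b) hz hM
  apply LipschitzOnWith.absolutelyContinuousOnInterval (K := C)
  rwa [uIcc_of_le hab]

/-- An absolutely continuous curve that satisfies an autonomous differential equation with
continuous right-hand side almost everywhere satisfies it everywhere, one-sidedly at the
endpoints: the curve differs from the integral of the right-hand side by a constant. -/
theorem hasDerivWithinAt_of_ae_hasDerivAt [CompleteSpace E] (hf : Continuous f) (hab : a ≤ b)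
    (hz : AbsolutelyContinuousOnInterval z a b)
    (hd : ∀ᵐ t : ℝ, t ∈ Ioo a b → HasDerivAt z (f (z t)) t) :
    ∀ t ∈ Icc a b, HasDerivWithinAt z (f (z t)) (Icc a b) t := by
  have hzc : ContinuousOn z (Icc a b) := by
    have := hz.continuousOn
    rwa [uIcc_of_le hab] at this
  have hp : ∀ t ∈ Icc a b,
      HasDerivWithinAt (ODE.picard (fun _ => f) a (z a) z) (f (z t)) (Icc a b) t := by
    intro t ht
    exact ODE.hasDerivWithinAt_picard_Icc (f := fun _ => f) (u := univ) (left_mem_Icc.2 hab)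
      (by exact (hf.comp continuous_snd).continuousOn) hzc (fun _ _ => mem_univ _) (z a) ht
  have hpac := absolutelyContinuousOnInterval_of_hasDerivWithinAt hab
    (hf.comp_continuousOn hzc) hp
  have h0 : ∀ᵐ t : ℝ, t ∈ uIcc a b →
      HasDerivAt (z - ODE.picard (fun _ => f) a (z a) z) 0 t := by
    have hne : ∀ᵐ t : ℝ, t ∉ ({a, b} : Set ℝ) := (Set.toFinite {a, b}).countable.ae_notMem volume
    filter_upwards [hd, hne] with t ht hn htab
    rw [uIcc_of_le hab] at htab
    have hto : t ∈ Ioo a b := by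
      simp only [mem_insert_iff, mem_singleton_iff, not_or] at hn
      exact ⟨lt_of_le_of_ne htab.1 (Ne.symm hn.1), lt_of_le_of_ne htab.2 hn.2⟩
    have := (ht hto).sub ((hp t htab).hasDerivAt (Icc_mem_nhds hto.1 hto.2))
    rwa [sub_self] at this
  obtain ⟨C, hC⟩ := (hz.sub hpac).const_of_ae_hasDerivAt_zero h0
  rw [uIcc_of_le hab] at hC
  have hC0 : C = 0 := by
    rw [← hC a (left_mem_Icc.2 hab)]
    simp
  have heq : ∀ t ∈ Icc a b, z t = ODE.picard (fun _ => f) a (z a) z t := by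
    intro t ht
    have := hC t ht
    rwa [hC0, Pi.sub_apply, sub_eq_zero] at this
  intro t ht
  exact (hp t ht).congr heq (heq t ht)

end Curves

/-! ### Hybrid time domains and solutions -/

/-- Each interval of flow of a hybrid time domain starts at the time of the jump that precedes it. -/
theorem IsHybridTimeDomain.exists_jumpTime {D : Set (ℝ × ℕ)} (hD : IsHybridTimeDomain D) :
    (0, 0) ∈ D ∧ (∀ t, (t, 0) ∈ D → 0 ≤ t) ∧
      ∀ t j, (t, j + 1) ∈ D → ∃ s ≤ t, (s, j) ∈ D ∧ (s, j + 1) ∈ D := by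
  obtain ⟨t, ht0, hmono, h⟩ := hD
  have hle : ∀ j, t j ≤ t (j + 1) := fun j => hmono (Nat.le_succ j)
  rcases h with rfl | ⟨J, rfl⟩ | ⟨J, T, hT, rfl⟩ | ⟨J, rfl⟩
  · refine ⟨?_, ?_, ?_⟩
    · simpa [ht0] using hle 0
    · intro s hs
      simpa [ht0] using hs.1
    · intro s j hs
      exact ⟨t (j + 1), hs.1, ⟨hle j, le_rfl⟩, ⟨le_rfl, hle _⟩⟩
  · refine ⟨?_, ?_, ?_⟩
    · simpa [ht0] using hle 0
    · intro s hs
      simpa [ht0] using hs.2.1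
    · intro s j hs
      exact ⟨t (j + 1), hs.2.1, ⟨(Nat.le_succ j).trans hs.1, hle j, le_rfl⟩,
        ⟨hs.1, le_rfl, hle _⟩⟩
  · refine ⟨?_, ?_, ?_⟩
    · rcases Nat.eq_zero_or_pos J with rfl | hJ
      · exact Or.inr ⟨rfl, by simp [ht0], by simpa [ht0] using hT⟩
      · exact Or.inl ⟨hJ, by simpa [ht0] using hle 0⟩
    · rintro s (hs | hs)
      · simpa [ht0] using hs.2.1
      · have h1 : 0 = J := hs.1
        have := hs.2.1
        rwa [← h1, ht0] at this
    · rintro s j (hs | hs)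
      · exact ⟨t (j + 1), hs.2.1, Or.inl ⟨(Nat.lt_succ_self j).trans hs.1, hle j, le_rfl⟩,
          Or.inl ⟨hs.1, le_rfl, hle _⟩⟩
      · have h1 : j + 1 = J := hs.1
        subst h1
        exact ⟨t (j + 1), hs.2.1, Or.inl ⟨Nat.lt_succ_self j, hle j, le_rfl⟩,
          Or.inr ⟨rfl, le_rfl, hT⟩⟩
  · refine ⟨?_, ?_, ?_⟩
    · rcases Nat.eq_zero_or_pos J with rfl | hJ
      · exact Or.inr ⟨rfl, by simp [ht0]⟩
      · exact Or.inl ⟨hJ, by simpa [ht0] using hle 0⟩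
    · rintro s (hs | hs)
      · simpa [ht0] using hs.2.1
      · have h1 : 0 = J := hs.1
        have : t J ≤ s := hs.2
        rwa [← h1, ht0] at this
    · rintro s j (hs | hs)
      · exact ⟨t (j + 1), hs.2.1, Or.inl ⟨(Nat.lt_succ_self j).trans hs.1, hle j, le_rfl⟩,
          Or.inl ⟨hs.1, le_rfl, hle _⟩⟩
      · have h1 : j + 1 = J := hs.1
        subst h1
        exact ⟨t (j + 1), hs.2, Or.inl ⟨Nat.lt_succ_self j, hle j, le_rfl⟩,
          Or.inr ⟨rfl, mem_Ici.2 le_rfl⟩⟩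

theorem IsHybridTimeDomain.ordConnected {D : Set (ℝ × ℕ)} (hD : IsHybridTimeDomain D)
    {a b s : ℝ} {j : ℕ} (ha : (a, j) ∈ D) (hb : (b, j) ∈ D) (hs : s ∈ Icc a b) : (s, j) ∈ D := by
  obtain ⟨t, -, -, h⟩ := hD
  rcases h with rfl | ⟨J, rfl⟩ | ⟨J, T, hT, rfl⟩ | ⟨J, rfl⟩
  · exact ⟨ha.1.trans hs.1, hs.2.trans hb.2⟩
  · exact ⟨ha.1, ha.2.1.trans hs.1, hs.2.trans hb.2.2⟩
  · rcases ha with ha | ha <;> rcases hb with hb | hb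
    · exact Or.inl ⟨ha.1, ha.2.1.trans hs.1, hs.2.trans hb.2.2⟩
    · exact absurd hb.1 (ne_of_lt ha.1)
    · exact absurd ha.1 (ne_of_lt hb.1)
    · exact Or.inr ⟨ha.1, ha.2.1.trans hs.1, hs.2.trans_lt hb.2.2⟩
  · rcases ha with ha | ha <;> rcases hb with hb | hb
    · exact Or.inl ⟨ha.1, ha.2.1.trans hs.1, hs.2.trans hb.2.2⟩
    · exact absurd hb.1 (ne_of_lt ha.1)
    · exact absurd ha.1 (ne_of_lt hb.1)
    · exact Or.inr ⟨ha.1, le_trans ha.2 hs.1⟩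

/-- Induction along a hybrid time domain: a property that holds initially, and that flows and jumps
preserve, holds throughout. -/
theorem IsHybridTimeDomain.induction {D : Set (ℝ × ℕ)} (hD : IsHybridTimeDomain D)
    {P : ℝ → ℕ → Prop} (zero : P 0 0)
    (flow : ∀ j a b, a ≤ b → (a, j) ∈ D → (b, j) ∈ D → P a j → P b j)
    (jump : ∀ j t, (t, j) ∈ D → (t, j + 1) ∈ D → P t j → P t (j + 1)) :
    ∀ j t, (t, j) ∈ D → P t j := by
  obtain ⟨h00, h0, hs⟩ := hD.exists_jumpTime
  intro j
  induction j with
  | zero => exact fun t ht => flow 0 0 t (h0 t ht) h00 ht zero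
  | succ j ih =>
    intro t ht
    obtain ⟨s, hst, hsj, hsj'⟩ := hs t j ht
    exact flow (j + 1) s t hst hsj' ht (jump j s hsj hsj' (ih s hsj))

theorem HybridArc.Ioo_subset_interior_flowInterval {E : Type*} [NormedAddCommGroup E]
    (φ : HybridArc E) {a b : ℝ} {j : ℕ} (ha : (a, j) ∈ φ.dom)
    (hb : (b, j) ∈ φ.dom) : Ioo a b ⊆ interior (φ.flowInterval j) :=
  interior_maximal (fun _ hs => φ.isHybridTimeDomain.ordConnected ha hb (Ioo_subset_Icc_self hs))
    isOpen_Ioo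

section Solutions

variable {E : Type*} [NormedAddCommGroup E] [NormedSpace ℝ E] {H : HybridSystem E}
  {φ : HybridArc E} {a b : ℝ} {j : ℕ}

/-- If the flow map is continuous, a solution satisfies the differential equation at every time of
an interval of flow, endpoints included. -/
theorem IsSolution.hasDerivWithinAt [CompleteSpace E] (hφ : IsSolution H φ) (hf : Continuous H.f)
    (hab : a ≤ b) (ha : (a, j) ∈ φ.dom) (hb : (b, j) ∈ φ.dom) :
    ∀ t ∈ Icc a b, HasDerivWithinAt (fun s => φ.toFun s j) (H.f (φ.toFun t j)) (Icc a b) t :=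
  hasDerivWithinAt_of_ae_hasDerivAt (z := fun s => φ.toFun s j) hf hab
    (φ.locallyAbsolutelyContinuous j a b hab ha hb)
    ((hφ.flow_deriv j).mono fun _ ht hto => ht (φ.Ioo_subset_interior_flowInterval ha hb hto))

/-- A solution lies in the flow set, if that set is closed, also at the ends of a nondegenerate
interval of flow. -/
theorem IsSolution.mem_flowSet (hφ : IsSolution H φ) (hC : IsClosed H.C) (hab : a < b)
    (ha : (a, j) ∈ φ.dom) (hb : (b, j) ∈ φ.dom) : ∀ t ∈ Icc a b, φ.toFun t j ∈ H.C := by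
  have hc : ContinuousOn (fun s => φ.toFun s j) (Icc a b) := by
    have := (φ.locallyAbsolutelyContinuous j a b hab.le ha hb).continuousOn
    rwa [uIcc_of_le hab.le] at this
  have hm : MapsTo (fun s => φ.toFun s j) (Ioo a b) H.C := fun t ht =>
    hφ.flow_mem j t (φ.Ioo_subset_interior_flowInterval ha hb ht)
  rw [← closure_Ioo hab.ne] at hc ⊢
  intro t ht
  simpa only [hC.closure_eq] using hm.closure_of_continuousOn hc ht

end Solutions

/-! ### Maximal solutions that stay bounded are complete -/

section Extension

/-- The hybrid time domain with jump times `t 1 ≤ … ≤ t J` whose last interval of flow consists of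
the times in `I`. -/
def truncatedDomain (t : ℕ → ℝ) (J : ℕ) (I : Set ℝ) : Set (ℝ × ℕ) :=
  {p | p.2 < J ∧ p.1 ∈ Icc (t p.2) (t (p.2 + 1))} ∪ {p | p.2 = J ∧ p.1 ∈ I}

variable {t : ℕ → ℝ} {J j : ℕ} {I : Set ℝ} {s T : ℝ}

theorem mem_truncatedDomain_of_lt (hj : j < J) :
    (s, j) ∈ truncatedDomain t J I ↔ s ∈ Icc (t j) (t (j + 1)) := by
  simp [truncatedDomain, hj, hj.ne]

theorem mem_truncatedDomain_self : (s, J) ∈ truncatedDomain t J I ↔ s ∈ I := by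
  simp [truncatedDomain]

theorem le_of_mem_truncatedDomain (h : (s, j) ∈ truncatedDomain t J I) : j ≤ J := by
  rcases h with h | h
  · exact h.1.le
  · exact h.1.le

theorem truncatedDomain_Icc (t : ℕ → ℝ) (J : ℕ) :
    truncatedDomain t J (Icc (t J) (t (J + 1))) =
      {p | p.2 ≤ J ∧ p.1 ∈ Icc (t p.2) (t (p.2 + 1))} := by
  ext ⟨s, j⟩
  rcases lt_trichotomy j J with h | rfl | h
  · simp [mem_truncatedDomain_of_lt h, h.le]
  · simp [mem_truncatedDomain_self]
  · simp [truncatedDomain, h.not_gt, h.ne', h.not_ge]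

theorem isHybridTimeDomain_truncatedDomain (ht0 : t 0 = 0) (ht : Monotone t) (hT : t J ≤ T) :
    IsHybridTimeDomain (truncatedDomain t J (Icc (t J) T)) := by
  refine ⟨fun k => if k ≤ J then t k else T, by simp [ht0], monotone_nat_of_le_succ fun k => ?_,
    Or.inr (Or.inl ⟨J, ?_⟩)⟩
  · rcases lt_trichotomy k J with h | rfl | h
    · simpa [h.le, Nat.succ_le_of_lt h] using ht (Nat.le_succ k)
    · simpa using hT
    · simp [h.not_ge, (h.trans (Nat.lt_succ_self k)).not_ge]
  · ext ⟨s, j⟩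
    rcases lt_trichotomy j J with h | rfl | h
    · simp [mem_truncatedDomain_of_lt h, h.le, h]
    · simp [mem_truncatedDomain_self]
    · simp [truncatedDomain, h.not_gt, h.ne', h.not_ge]

variable {E : Type*} [NormedAddCommGroup E] [NormedSpace ℝ E] {H : HybridSystem E}
  {φ : HybridArc E}

/-- A solution that ends at a point from which a jump is possible is not maximal. -/
theorem IsMaximalSolution.false_of_jump (hφ : IsMaximalSolution H φ) (ht0 : t 0 = 0)
    (ht : Monotone t) (hdom : φ.dom = truncatedDomain t J (Icc (t J) (t (J + 1))))
    (hD : φ.toFun (t (J + 1)) J ∈ H.D) {g : E} (hg : g ∈ H.G (φ.toFun (t (J + 1)) J)) : False := by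
  obtain ⟨hs, hmax⟩ := hφ
  set D' := truncatedDomain t (J + 1) (Icc (t (J + 1)) (t (J + 1))) with hD'
  have hold : ∀ s j, j ≤ J → ((s, j) ∈ D' ↔ (s, j) ∈ φ.dom) := by
    intro s j hj
    rw [hD', mem_truncatedDomain_of_lt (Nat.lt_succ_of_le hj), hdom, truncatedDomain_Icc]
    simp [hj]
  have hnew : ∀ s, (s, J + 1) ∈ D' ↔ s = t (J + 1) := by
    intro s
    rw [hD', mem_truncatedDomain_self, Icc_self, mem_singleton_iff]
  have hnot : ∀ s, (s, J + 1) ∉ φ.dom := by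
    intro s h
    rw [hdom] at h
    exact absurd (le_of_mem_truncatedDomain h) (Nat.not_succ_le_self J)
  let ψ : HybridArc E :=
    { dom := D'
      toFun := fun s j => if j = J + 1 then g else φ.toFun s j
      isHybridTimeDomain := isHybridTimeDomain_truncatedDomain ht0 ht le_rfl
      locallyAbsolutelyContinuous := by
        intro j a b hab ha hb
        rcases eq_or_ne j (J + 1) with rfl | hj
        · simp only [if_true]
          exact absolutelyContinuousOnInterval_of_hasDerivWithinAt (v := fun _ => 0) hab
            continuousOn_const fun s _ => hasDerivWithinAt_const s _ g
        · have hjJ : j ≤ J := Nat.le_of_lt_succ (lt_of_le_of_ne (le_of_mem_truncatedDomain ha) hj)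
          simp only [hj, if_false]
          exact φ.locallyAbsolutelyContinuous j a b hab ((hold a j hjJ).1 ha)
            ((hold b j hjJ).1 hb) }
  have hint : ∀ j, interior (ψ.flowInterval j) ⊆ interior (φ.flowInterval j) ∧
      (j = J + 1 → interior (ψ.flowInterval j) = ∅) := by
    intro j
    rcases le_or_gt j J with hj | hj
    · have : ψ.flowInterval j = φ.flowInterval j := by
        ext s
        exact hold s j hj
      rw [this]
      exact ⟨Subset.rfl, fun h => by omega⟩
    · have : ψ.flowInterval j ⊆ {t (J + 1)} := by
        intro s hs
        have hjJ : j = J + 1 := le_antisymm (le_of_mem_truncatedDomain hs) hj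
        subst hjJ
        exact (hnew s).1 hs
      have he : interior (ψ.flowInterval j) = ∅ :=
        subset_empty_iff.1 ((interior_mono this).trans (interior_singleton (t (J + 1))).subset)
      exact ⟨by rw [he]; exact empty_subset _, fun _ => he⟩
  refine hmax ⟨ψ, ⟨?_, ?_, ?_, ?_⟩, ⟨?_, ?_⟩, ?_⟩
  · simpa [ψ] using hs.initial
  · intro j s hsj
    have hj : j ≠ J + 1 := by
      intro h
      rw [(hint j).2 h] at hsj
      exact hsj
    simpa [ψ, hj] using hs.flow_mem j s ((hint j).1 hsj)
  · intro j
    rcases eq_or_ne j (J + 1) with hj | hj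
    · rw [(hint j).2 hj]
      simp
    · filter_upwards [hs.flow_deriv j] with s h hsj
      simpa [ψ, hj] using h ((hint j).1 hsj)
  · intro s j hsj hsj'
    have hj1 : j + 1 ≤ J + 1 := le_of_mem_truncatedDomain hsj'
    have hj : j ≤ J := Nat.le_of_succ_le_succ hj1
    rcases eq_or_ne j J with rfl | hne
    · have hst := (hnew s).1 hsj'
      subst hst
      simpa [ψ] using And.intro hD hg
    · have hj2 : j + 1 ≤ J := lt_of_le_of_ne hj hne
      have h := hs.jump s j ((hold s j hj).1 hsj) ((hold s (j + 1) hj2).1 hsj')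
      have h3 : j ≠ J + 1 := by omega
      simpa [ψ, hne, h3] using h
  · rintro ⟨s, j⟩ h
    refine (hold s j ?_).2 h
    rw [hdom] at h
    exact le_of_mem_truncatedDomain h
  · exact fun h => hnot _ (h ((hnew _).2 rfl))
  · intro s j h
    have hj : j ≠ J + 1 := by
      rintro rfl
      exact hnot s h
    simp [ψ, hj]

/-- A solution whose last piece of flow extends to a longer piece of flow is not maximal. -/
theorem IsMaximalSolution.false_of_flow (hφ : IsMaximalSolution H φ) (ht0 : t 0 = 0)
    (ht : Monotone t) (hdom : φ.dom = truncatedDomain t J I) (hJI : t J ∈ I)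
    (hI : I ⊆ Icc (t J) T) (hT : T ∉ I) {g : ℝ → E} (hg : ∀ s ∈ I, g s = φ.toFun s J)
    (hgac : AbsolutelyContinuousOnInterval g (t J) T) (hgC : ∀ s ∈ Ioo (t J) T, g s ∈ H.C)
    (hgd : ∀ᵐ s : ℝ, s ∈ Ioo (t J) T → HasDerivAt g (H.f (g s)) s) : False := by
  obtain ⟨hs, hmax⟩ := hφ
  have hTJ : t J ≤ T := (hI hJI).2
  set D' := truncatedDomain t J (Icc (t J) T) with hD'
  have hold : ∀ s j, j ≠ J → ((s, j) ∈ D' ↔ (s, j) ∈ φ.dom) := by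
    intro s j hj
    rw [hD', hdom]
    simp [truncatedDomain, hj]
  have hnew : ∀ s, (s, J) ∈ D' ↔ s ∈ Icc (t J) T := fun s => by
    rw [hD', mem_truncatedDomain_self]
  have hJ : ∀ s, (s, J) ∈ φ.dom ↔ s ∈ I := fun s => by
    rw [hdom, mem_truncatedDomain_self]
  let ψ : HybridArc E :=
    { dom := D'
      toFun := fun s j => if j = J then g s else φ.toFun s j
      isHybridTimeDomain := isHybridTimeDomain_truncatedDomain ht0 ht hTJ
      locallyAbsolutelyContinuous := by
        intro j a b hab ha hb
        rcases eq_or_ne j J with rfl | hj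
        · simp only [if_true]
          refine hgac.mono ?_
          rw [uIcc_of_le hab, uIcc_of_le hTJ]
          exact Icc_subset_Icc ((hnew a).1 ha).1 ((hnew b).1 hb).2
        · simp only [hj, if_false]
          exact φ.locallyAbsolutelyContinuous j a b hab ((hold a j hj).1 ha) ((hold b j hj).1 hb) }
  have hint : ∀ j, j ≠ J → ψ.flowInterval j = φ.flowInterval j := fun j hj => by
    ext s
    exact hold s j hj
  have hintJ : interior (ψ.flowInterval J) = Ioo (t J) T := by
    have : ψ.flowInterval J = Icc (t J) T := by
      ext s
      exact hnew s
    rw [this, interior_Icc]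
  have hagree : ∀ s j, (s, j) ∈ φ.dom → ψ.toFun s j = φ.toFun s j := by
    intro s j h
    rcases eq_or_ne j J with rfl | hj
    · simpa [ψ] using hg s ((hJ s).1 h)
    · simp [ψ, hj]
  refine hmax ⟨ψ, ⟨?_, ?_, ?_, ?_⟩, ⟨?_, ?_⟩, hagree⟩
  · rw [hagree 0 0 φ.isHybridTimeDomain.exists_jumpTime.1]
    exact hs.initial
  · intro j s hsj
    rcases eq_or_ne j J with rfl | hj
    · rw [hintJ] at hsj
      simpa [ψ] using hgC s hsj
    · rw [hint j hj] at hsj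
      simpa [ψ, hj] using hs.flow_mem j s hsj
  · intro j
    rcases eq_or_ne j J with rfl | hj
    · rw [hintJ]
      simpa [ψ] using hgd
    · rw [hint j hj]
      simpa [ψ, hj] using hs.flow_deriv j
  · intro s j hsj hsj'
    have hjJ : j + 1 ≤ J := le_of_mem_truncatedDomain hsj'
    have hj : j ≠ J := by omega
    have h1 : (s, j) ∈ φ.dom := (hold s j hj).1 hsj
    have h2 : (s, j + 1) ∈ φ.dom := by
      rcases eq_or_ne (j + 1) J with rfl | hj'
      · have hsj := (mem_truncatedDomain_of_lt (Nat.lt_succ_self j)).1 hsj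
        have hst : s = t (j + 1) := le_antisymm hsj.2 ((hnew s).1 hsj').1
        rw [hJ, hst]
        exact hJI
      · exact (hold s (j + 1) hj').1 hsj'
    rw [hagree s j h1, hagree s (j + 1) h2]
    exact hs.jump s j h1 h2
  · rintro ⟨s, j⟩ h
    rcases eq_or_ne j J with rfl | hj
    · exact (hnew s).2 (hI ((hJ s).1 h))
    · exact (hold s j hj).2 h
  · exact fun h => hT ((hJ T).1 (h ((hnew T).2 (right_mem_Icc.2 hTJ))))

/-- Two pieces of flow that meet can be concatenated. -/
theorem hasDerivWithinAt_concat {f : E → E} {y z : ℝ → E} {a b c : ℝ}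
    (hzy : z b = y b) (hab : a ≤ b) (hbc : b ≤ c)
    (hz : ∀ s ∈ Icc a b, HasDerivWithinAt z (f (z s)) (Icc a b) s)
    (hy : ∀ s ∈ Icc b c, HasDerivWithinAt y (f (y s)) (Icc b c) s) :
    let g := fun s => if s ≤ b then z s else y s
    ∀ s ∈ Icc a c, HasDerivWithinAt g (f (g s)) (Icc a c) s := by
  intro g
  have hgz : ∀ s ∈ Icc a b, g s = z s := fun s hs => by simp [g, hs.2]
  have hgy : ∀ s ∈ Icc b c, g s = y s := fun s hs => by
    rcases hs.1.eq_or_lt with rfl | h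
    · simpa [g] using hzy
    · simp [g, h.not_ge]
  intro s hs
  rw [← Icc_union_Icc_eq_Icc hab hbc]
  refine HasDerivWithinAt.union ?_ ?_
  · by_cases hsb : s ≤ b
    · have hs' : s ∈ Icc a b := ⟨hs.1, hsb⟩
      have := (hz s hs').congr hgz (hgz s hs')
      rwa [← hgz s hs'] at this
    · refine HasFDerivWithinAt.of_notMem_closure ?_
      rw [closure_Icc]
      exact fun h => hsb h.2
  · by_cases hsb : b ≤ s
    · have hs' : s ∈ Icc b c := ⟨hsb, hs.2⟩
      have := (hy s hs').congr hgy (hgy s hs')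
      rwa [← hgy s hs'] at this
    · refine HasFDerivWithinAt.of_notMem_closure ?_
      rw [closure_Icc]
      exact fun h => hsb h.1

/-- A maximal solution is complete if its velocity is bounded and if, at each of its points, either
a jump is possible or some flow starts. A solution that stops with an open interval of flow has a
limit there because it is Lipschitz, so its interval of flow can be closed; one that stops with a
closed interval of flow can jump or flow on. -/
theorem IsMaximalSolution.isComplete [FiniteDimensional ℝ E] (hφ : IsMaximalSolution H φ)
    (hf : Continuous H.f) (hC : IsClosed H.C) (hG : ∀ x ∈ H.D, (H.G x).Nonempty)
    {M : ℝ} (hM : ∀ s j, (s, j) ∈ φ.dom → ‖H.f (φ.toFun s j)‖ ≤ M)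
    (hflow : ∀ s j, (s, j) ∈ φ.dom → φ.toFun s j ∉ H.D →
      ∃ T > s, ∃ y : ℝ → E, y s = φ.toFun s j ∧ ∀ r ∈ Icc s T,
        HasDerivWithinAt y (H.f (y r)) (Icc s T) r ∧ y r ∈ H.C) :
    IsComplete φ := by
  have : CompleteSpace E := FiniteDimensional.complete ℝ E
  obtain ⟨t, ht0, ht, h⟩ := φ.isHybridTimeDomain
  intro hb
  have hle : ∀ j, t j ≤ t (j + 1) := fun j => ht (Nat.le_succ j)
  rcases h with h | ⟨J, h⟩ | ⟨J, T, hT, h⟩ | ⟨J, h⟩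
  · obtain ⟨r, hr⟩ := hb.subset_closedBall (0, 0)
    obtain ⟨j, hj⟩ := exists_nat_gt r
    have hm : (t j, j) ∈ φ.dom := by
      rw [h]
      exact ⟨le_rfl, hle j⟩
    have h1 := hr hm
    rw [Metric.mem_closedBall, Prod.dist_eq] at h1
    have h2 := (le_max_right _ _).trans h1
    rw [Nat.dist_eq] at h2
    simp at h2
    linarith
  · rw [← truncatedDomain_Icc] at h
    have hm : ∀ s, (s, J) ∈ φ.dom ↔ s ∈ Icc (t J) (t (J + 1)) := fun s => by
      rw [h, mem_truncatedDomain_self]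
    have hmr : (t (J + 1), J) ∈ φ.dom := (hm _).2 (right_mem_Icc.2 (hle J))
    by_cases hD : φ.toFun (t (J + 1)) J ∈ H.D
    · obtain ⟨g, hg⟩ := hG _ hD
      exact hφ.false_of_jump ht0 ht h hD hg
    · obtain ⟨T, hT, y, hy0, hy⟩ := hflow _ J hmr hD
      have hz := hφ.1.hasDerivWithinAt hf (hle J) ((hm _).2 (left_mem_Icc.2 (hle J))) hmr
      have hg := hasDerivWithinAt_concat hy0.symm (hle J) hT.le hz fun s hs => (hy s hs).1
      set g : ℝ → E := fun s => if s ≤ t (J + 1) then φ.toFun s J else y s with hgdef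
      have hgc : ContinuousOn g (Icc (t J) T) := fun s hs => (hg s hs).continuousWithinAt
      refine hφ.false_of_flow (T := T) (g := g) ht0 ht h (left_mem_Icc.2 (hle J))
        (Icc_subset_Icc_right hT.le) (fun h => hT.not_ge h.2) ?_
        (absolutelyContinuousOnInterval_of_hasDerivWithinAt ((hle J).trans hT.le)
          (hf.comp_continuousOn hgc) hg) ?_ ?_
      · intro s hs
        simp [hgdef, hs.2]
      · intro s hs
        by_cases hst : s ≤ t (J + 1)
        · simp only [hgdef, hst, if_true]
          exact hφ.1.mem_flowSet hC (hs.1.trans_le hst) ((hm _).2 (left_mem_Icc.2 (hle J))) hmr s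
            ⟨hs.1.le, hst⟩
        · simp only [hgdef, hst, if_false]
          exact (hy s ⟨(not_le.1 hst).le, hs.2.le⟩).2
      · exact .of_forall fun s hs => (hg s ⟨hs.1.le, hs.2.le⟩).hasDerivAt (Icc_mem_nhds hs.1 hs.2)
  · have hm : ∀ s, (s, J) ∈ φ.dom ↔ s ∈ Ico (t J) T := fun s => by
      rw [h]
      exact mem_truncatedDomain_self
    have hint : interior (φ.flowInterval J) = Ioo (t J) T := by
      have : φ.flowInterval J = Ico (t J) T := by
        ext s
        exact hm s
      rw [this, interior_Ico]
    have hz : ∀ s ∈ Ico (t J) T,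
        HasDerivWithinAt (fun r => φ.toFun r J) (H.f (φ.toFun s J)) (Ico (t J) T) s := by
      intro s hs
      obtain ⟨r, hsr, hrT⟩ := exists_between hs.2
      have htr : t J ≤ r := hs.1.trans hsr.le
      have h1 := hφ.1.hasDerivWithinAt hf htr ((hm _).2 ⟨le_rfl, hT⟩) ((hm r).2 ⟨htr, hrT⟩) s
        ⟨hs.1, hsr.le⟩
      refine h1.mono_of_mem_nhdsWithin ?_
      filter_upwards [self_mem_nhdsWithin, mem_nhdsWithin_of_mem_nhds (Iio_mem_nhds hsr)]
        with u hu hur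
      exact ⟨hu.1, le_of_lt hur⟩
    obtain ⟨C, hCl⟩ := exists_lipschitzOnWith_of_hasDerivWithinAt (convex_Ico (t J) T) hz
      fun s hs => hM s J ((hm s).2 hs)
    obtain ⟨g, hgl, hg⟩ := hCl.extend_finite_dimension
    refine hφ.false_of_flow (T := T) (g := g) ht0 ht h ⟨le_rfl, hT⟩ Ico_subset_Icc_self
      (fun h => h.2.false) (fun s hs => (hg hs).symm)
      (hgl.lipschitzOnWith.absolutelyContinuousOnInterval) ?_ ?_
    · intro s hs
      rw [← hg ⟨hs.1.le, hs.2⟩]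
      exact hφ.1.flow_mem J s (by rwa [hint])
    · refine .of_forall fun s hs => ?_
      rw [← hg ⟨hs.1.le, hs.2⟩]
      refine ((hz s ⟨hs.1.le, hs.2⟩).hasDerivAt (Ico_mem_nhds hs.1 hs.2)).congr_of_eventuallyEq ?_
      filter_upwards [Ico_mem_nhds hs.1 hs.2] with r hr
      exact (hg hr).symm
  · obtain ⟨r, hr⟩ := hb.subset_closedBall (0, 0)
    have hm : (max (t J) (r + 1), J) ∈ φ.dom := by
      rw [h]
      exact Or.inr ⟨rfl, mem_Ici.2 (le_max_left _ _)⟩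
    have h1 := hr hm
    rw [Metric.mem_closedBall, Prod.dist_eq] at h1
    have h2 := (le_max_left _ _).trans h1
    rw [Real.dist_eq, sub_zero] at h2
    linarith [le_abs_self (max (t J) (r + 1)), le_max_right (t J) (r + 1)]

end Extension

/-- The Picard–Lindelöf theorem for a globally Lipschitz vector field: a flow starts at each
point. -/
theorem exists_flow_of_lipschitzWith {E : Type*} [NormedAddCommGroup E] [NormedSpace ℝ E]
    [CompleteSpace E] {f : E → E} {K : NNReal} (hf : LipschitzWith K f) (x : E) (s : ℝ) :
    ∃ T > s, ∃ y : ℝ → E, y s = x ∧ ∀ r ∈ Icc s T, HasDerivWithinAt y (f (y r)) (Icc s T) r := by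
  set L : NNReal := ‖f x‖₊ + K with hL
  have hL0 : (0 : ℝ) < (L : ℝ) + 1 := by positivity
  have hpos : (0 : ℝ) < 1 / ((L : ℝ) + 1) := by positivity
  have hsT : s ≤ s + 1 / ((L : ℝ) + 1) := by linarith
  have hpl : IsPicardLindelof (fun _ => f) (tmin := s) (tmax := s + 1 / ((L : ℝ) + 1))
      ⟨s, left_mem_Icc.2 hsT⟩ x 1 0 L K := by
    refine .of_time_independent ?_ hf.lipschitzOnWith ?_
    · intro z hz
      have h1 : ‖f z - f x‖ ≤ K * ‖z - x‖ := by
        simpa [dist_eq_norm] using hf.dist_le_mul z x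
      have h2 : ‖z - x‖ ≤ 1 := by simpa [dist_eq_norm] using hz
      have h3 : (K : ℝ) * ‖z - x‖ ≤ K := mul_le_of_le_one_right K.2 h2
      have h4 := norm_le_norm_add_norm_sub (f x) (f z)
      rw [hL, NNReal.coe_add, coe_nnnorm]
      rw [norm_sub_rev] at h1
      linarith
    · have : (L : ℝ) * (1 / ((L : ℝ) + 1)) ≤ 1 := by
        rw [mul_one_div, div_le_one hL0]
        linarith
      simpa [max_eq_left (inv_pos.2 hL0).le] using this
  obtain ⟨y, hy0, hy⟩ := hpl.exists_eq_forall_mem_Icc_hasDerivWithinAt₀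
  exact ⟨_, by linarith, y, hy0, hy⟩

/-! ### Quadratic forms -/

section QuadraticForms

variable {ι : Type*} [Fintype ι]

theorem dotProduct_transpose_mulVec_comm {κ : Type*} [Fintype κ] (M : Matrix ι κ ℝ) (x : κ → ℝ)
    (y : ι → ℝ) : x ⬝ᵥ Mᵀ *ᵥ y = y ⬝ᵥ M *ᵥ x := by
  rw [mulVec_transpose, dotProduct_comm, dotProduct_mulVec]

theorem exists_pos_mul_dotProduct_le {M : Matrix ι ι ℝ} (hM : M.PosDef) :
    ∃ c > 0, ∀ x : ι → ℝ, c * (x ⬝ᵥ x) ≤ x ⬝ᵥ M *ᵥ x := by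
  have hcont : Continuous fun x : ι → ℝ => x ⬝ᵥ M *ᵥ x := by fun_prop
  have hpos : ∀ x : ι → ℝ, x ≠ 0 → 0 < x ⬝ᵥ M *ᵥ x := fun x hx => by
    simpa using hM.dotProduct_mulVec_pos hx
  have hbd : ∀ x : ι → ℝ, x ⬝ᵥ x ≤ Fintype.card ι * ‖x‖ ^ 2 := by
    intro x
    have : ∀ i ∈ Finset.univ, x i * x i ≤ ‖x‖ ^ 2 := fun i _ => by
      have h := norm_le_pi_norm x i
      rw [Real.norm_eq_abs] at h
      nlinarith [abs_mul_abs_self (x i), abs_nonneg (x i)]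
    simpa [dotProduct] using Finset.sum_le_card_nsmul _ _ _ this
  rcases (Metric.sphere (0 : ι → ℝ) 1).eq_empty_or_nonempty with he | hne
  · refine ⟨1, one_pos, fun x => ?_⟩
    have hx : x = 0 := by
      by_contra hx
      have : ‖x‖⁻¹ • x ∈ Metric.sphere (0 : ι → ℝ) 1 := by
        simp [norm_smul, inv_mul_cancel₀ (norm_ne_zero_iff.2 hx)]
      rw [he] at this
      exact this
    simp [hx]
  · obtain ⟨y, hy, hmin⟩ := (isCompact_sphere (0 : ι → ℝ) 1).exists_isMinOn hne hcont.continuousOn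
    have hy0 : y ≠ 0 := by
      rintro rfl
      simp at hy
    refine ⟨(y ⬝ᵥ M *ᵥ y) / (Fintype.card ι + 1), div_pos (hpos y hy0) (by positivity),
      fun x => ?_⟩
    rcases eq_or_ne x 0 with rfl | hx
    · simp
    have hn : 0 < ‖x‖ := norm_pos_iff.2 hx
    have hm : ‖x‖⁻¹ • x ∈ Metric.sphere (0 : ι → ℝ) 1 := by
      simp [norm_smul, inv_mul_cancel₀ hn.ne']
    have h1 : y ⬝ᵥ M *ᵥ y ≤ ‖x‖⁻¹ * (‖x‖⁻¹ * (x ⬝ᵥ M *ᵥ x)) := by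
      simpa [mulVec_smul] using hmin hm
    have h2 : (y ⬝ᵥ M *ᵥ y) * ‖x‖ ^ 2 ≤ x ⬝ᵥ M *ᵥ x := by
      calc (y ⬝ᵥ M *ᵥ y) * ‖x‖ ^ 2 ≤ ‖x‖⁻¹ * (‖x‖⁻¹ * (x ⬝ᵥ M *ᵥ x)) * ‖x‖ ^ 2 := by gcongr
        _ = x ⬝ᵥ M *ᵥ x := by field_simp
    rw [div_mul_eq_mul_div, div_le_iff₀ (by positivity)]
    have h3 := hpos y hy0
    have h4 := hpos x hx
    calc (y ⬝ᵥ M *ᵥ y) * (x ⬝ᵥ x) ≤ (y ⬝ᵥ M *ᵥ y) * (Fintype.card ι * ‖x‖ ^ 2) := by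
          gcongr
          exact hbd x
      _ = (y ⬝ᵥ M *ᵥ y) * ‖x‖ ^ 2 * Fintype.card ι := by ring
      _ ≤ (x ⬝ᵥ M *ᵥ x) * Fintype.card ι := by gcongr
      _ ≤ (x ⬝ᵥ M *ᵥ x) * (Fintype.card ι + 1) := by
          gcongr
          linarith

theorem exists_le_mul_dotProduct (M : Matrix ι ι ℝ) :
    ∃ b > 0, ∀ x : ι → ℝ, x ⬝ᵥ M *ᵥ x ≤ b * (x ⬝ᵥ x) := by
  refine ⟨∑ i, ∑ j, |M i j| + 1, by positivity, fun x => ?_⟩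
  have hx : 0 ≤ x ⬝ᵥ x := Finset.sum_nonneg fun i _ => mul_self_nonneg _
  have hle : ∀ i, x i * x i ≤ x ⬝ᵥ x := fun i =>
    Finset.single_le_sum (f := fun i => x i * x i) (fun i _ => mul_self_nonneg _)
      (Finset.mem_univ i)
  calc x ⬝ᵥ M *ᵥ x = ∑ i, ∑ j, x i * (M i j * x j) := by
        simp [dotProduct, mulVec, Finset.mul_sum]
    _ ≤ ∑ i, ∑ j, |M i j| * (x ⬝ᵥ x) := by
        refine Finset.sum_le_sum fun i _ => Finset.sum_le_sum fun j _ => ?_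
        calc x i * (M i j * x j) = M i j * (x i * x j) := by ring
          _ ≤ |M i j * (x i * x j)| := le_abs_self _
          _ = |M i j| * |x i * x j| := abs_mul _ _
          _ ≤ |M i j| * (x ⬝ᵥ x) := by
            gcongr
            rw [abs_le]
            constructor <;> nlinarith [hle i, hle j, sq_nonneg (x i + x j), sq_nonneg (x i - x j)]
    _ = (∑ i, ∑ j, |M i j|) * (x ⬝ᵥ x) := by simp [Finset.sum_mul]
    _ ≤ (∑ i, ∑ j, |M i j| + 1) * (x ⬝ᵥ x) := by nlinarith

theorem hasDerivWithinAt_dotProduct_mulVec_self {M : Matrix ι ι ℝ} (hM : Mᵀ = M)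
    {u : ℝ → ι → ℝ} {u' : ι → ℝ} {s : Set ℝ} {t : ℝ}
    (hu : ∀ i, HasDerivWithinAt (fun r => u r i) (u' i) s t) :
    HasDerivWithinAt (fun r => u r ⬝ᵥ M *ᵥ u r) (2 * (u t ⬝ᵥ M *ᵥ u')) s t := by
  have h : HasDerivWithinAt (fun r => ∑ i, u r i * ∑ j, M i j * u r j)
      (∑ i, (u' i * (∑ j, M i j * u t j) + u t i * ∑ j, M i j * u' j)) s t :=
    HasDerivWithinAt.fun_sum fun i _ =>
      (hu i).mul (HasDerivWithinAt.fun_sum fun j _ => (hu j).const_mul (M i j))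
  refine h.congr_deriv ?_
  have hsymm : u' ⬝ᵥ M *ᵥ u t = u t ⬝ᵥ M *ᵥ u' := by
    conv_lhs => rw [← hM]
    exact dotProduct_transpose_mulVec_comm M _ _
  have : ∑ i, (u' i * (∑ j, M i j * u t j) + u t i * ∑ j, M i j * u' j) =
      u' ⬝ᵥ M *ᵥ u t + u t ⬝ᵥ M *ᵥ u' := by
    rw [Finset.sum_add_distrib]
    rfl
  rw [this, hsymm, two_mul]

end QuadraticForms

/-! ### Saturation -/

theorem abs_sat_sub_sat_le {a : ℝ} (ha : 0 < a) (v w : ℝ) :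
    |min |v| a * Real.sign v - min |w| a * Real.sign w| ≤ |v - w| := by
  have hsat : ∀ v : ℝ, min |v| a * Real.sign v = max (-a) (min v a) := by
    intro v
    rcases lt_trichotomy v 0 with h | rfl | h
    · rw [Real.sign_of_neg h, abs_of_neg h, min_eq_left (h.le.trans ha.le), mul_neg_one]
      rcases le_total (-v) a with hv | hv
      · rw [min_eq_left hv, max_eq_right (by linarith), neg_neg]
      · rw [min_eq_right hv, max_eq_left (by linarith)]
    · simp [ha.le]
    · rw [Real.sign_of_pos h, abs_of_pos h, mul_one, max_eq_right]
      exact le_min (by linarith) (by linarith)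
  rw [hsat, hsat]
  have h1 := abs_max_sub_max_le_max (-a) (min v a) (-a) (min w a)
  have h2 := abs_min_sub_min_le_max v a w a
  rw [sub_self, abs_zero, max_eq_right (abs_nonneg (min v a - min w a))] at h1
  rw [sub_self, abs_zero, max_eq_left (abs_nonneg (v - w))] at h2
  exact h1.trans h2

/-- The global Lipschitz estimate behind the existence of flows. -/
theorem lipschitzWith_dz {m : ℕ} {ubar : Fin m → ℝ} (hubar : ∀ i, 0 < ubar i) :
    LipschitzWith 2 (dz ubar) := by
  have h1 : LipschitzWith 1 (sat ubar) := by
    refine LipschitzWith.of_dist_le_mul fun v w => ?_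
    rw [NNReal.coe_one, one_mul, dist_pi_le_iff dist_nonneg]
    intro i
    refine le_trans ?_ (dist_le_pi_dist v w i)
    exact abs_sat_sub_sat_le (hubar i) (v i) (w i)
  have h2 := h1.sub LipschitzWith.id
  rwa [one_add_one_eq_two] at h2

/-- The sector condition: where `|h| ≤ ubar i`, the `i`-th components of `dz v` and of
`sat v + h = dz v + v + h` do not have the same sign. -/
theorem dz_mul_add_nonpos {m : ℕ} {ubar : Fin m → ℝ} {i : Fin m} {h : ℝ}
    (hh : |h| ≤ ubar i) (v : Fin m → ℝ) : dz ubar v i * (dz ubar v i + v i + h) ≤ 0 := by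
  have he : dz ubar v i = min |v i| (ubar i) * Real.sign (v i) - v i := rfl
  rw [he]
  obtain ⟨h1, h2⟩ := abs_le.1 hh
  rcases lt_trichotomy (v i) 0 with hv | hv | hv
  · rw [Real.sign_of_neg hv, abs_of_neg hv]
    rcases le_total (-v i) (ubar i) with hle | hle
    · rw [min_eq_left hle]
      simp
    · rw [min_eq_right hle]
      nlinarith
  · simp [hv]
  · rw [Real.sign_of_pos hv, abs_of_pos hv]
    rcases le_total (v i) (ubar i) with hle | hle
    · rw [min_eq_left hle]
      simp
    · rw [min_eq_right hle]
      nlinarith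

/-! ### The Lyapunov function -/

section Lyapunov

variable {q m : ℕ} {n : Fin q → ℕ}

/-- The `i`-th cluster of a vector indexed by the coordinates of the plant state. -/
def cluster (i : Fin q) (η : PlantIdx n → ℝ) : Fin (n i) → ℝ := fun k => η ⟨i, k⟩

theorem dotProduct_blockDiagonal'_mulVec (M : (i : Fin q) → Matrix (Fin (n i)) (Fin (n i)) ℝ)
    (u v : PlantIdx n → ℝ) :
    u ⬝ᵥ blockDiagonal' M *ᵥ v = ∑ i, cluster i u ⬝ᵥ M i *ᵥ cluster i v := by
  have h : ∀ (i : Fin q) (k : Fin (n i)),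
      (blockDiagonal' M *ᵥ v) ⟨i, k⟩ = (M i *ᵥ cluster i v) k := by
    intro i k
    simp only [mulVec, dotProduct, Fintype.sum_sigma]
    rw [Finset.sum_eq_single i]
    · simp [cluster, blockDiagonal'_apply_eq]
    · intro j _ hj
      exact Finset.sum_eq_zero fun l _ => by rw [blockDiagonal'_apply_ne _ _ _ hj.symm, zero_mul]
    · simp
  simp only [dotProduct, Fintype.sum_sigma, h]
  rfl

/-- The Lyapunov function `x_pᵀ W⁻¹ x_p + ∑ exp (σ_i τ_i) η̃_iᵀ R_i η̃_i`. -/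
noncomputable def lyapunov (W : Matrix (PlantIdx n) (PlantIdx n) ℝ)
    (R : (i : Fin q) → Matrix (Fin (n i)) (Fin (n i)) ℝ) (σ : Fin q → ℝ)
    (p η : PlantIdx n → ℝ) (τ : Fin q → ℝ) : ℝ :=
  p ⬝ᵥ W⁻¹ *ᵥ p + ∑ i, Real.exp (σ i * τ i) * (cluster i η ⬝ᵥ R i *ᵥ cluster i η)

theorem dotProduct_Phat_mulVec (W : Matrix (PlantIdx n) (PlantIdx n) ℝ)
    (R : (i : Fin q) → Matrix (Fin (n i)) (Fin (n i)) ℝ) (σ τ : Fin q → ℝ) (x : State n) :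
    x.bar ⬝ᵥ Phat W R σ τ *ᵥ x.bar = lyapunov W R σ x.plant x.err τ := by
  have hx : x.bar = Sum.elim x.plant x.err := by
    ext (k | k) <;> rfl
  rw [hx, Phat, fromBlocks_mulVec]
  simp [dotProduct_blockDiagonal'_mulVec, lyapunov, smul_mulVec]

/-- The quadratic form of the design matrix, written so that it is visibly affine in `ψ` and that the
term in `α` vanishes for `η = W v`. -/
theorem dotProduct_designMatrix_mulVec (A : Matrix (PlantIdx n) (PlantIdx n) ℝ)
    (B : Matrix (PlantIdx n) (Fin m) ℝ) (W : Matrix (PlantIdx n) (PlantIdx n) ℝ)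
    (R : (i : Fin q) → Matrix (Fin (n i)) (Fin (n i)) ℝ) (σ ψ : Fin q → ℝ)
    (Y Z : Matrix (Fin m) (PlantIdx n) ℝ) (S : Matrix (Fin m) (Fin m) ℝ) (α : ℝ)
    (ξ v η : PlantIdx n → ℝ) (s : Fin m → ℝ) :
    Sum.elim (Sum.elim ξ v) (Sum.elim s η) ⬝ᵥ
        designMatrix A B W (blockDiagonal' R) (scalarBlocks n σ) (scalarBlocks n ψ) Y Z S α *ᵥ
          Sum.elim (Sum.elim ξ v) (Sum.elim s η) =
      2 * (ξ ⬝ᵥ (A *ᵥ W *ᵥ ξ + B *ᵥ Y *ᵥ ξ - B *ᵥ Y *ᵥ v + B *ᵥ S *ᵥ s)) -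
        2 * (s ⬝ᵥ (S *ᵥ s + (Y *ᵥ ξ - Y *ᵥ v) + Z *ᵥ ξ)) +
        2 * α * (v ⬝ᵥ (η - W *ᵥ v)) +
        ∑ i, ψ i * (2 * (cluster i η ⬝ᵥ R i *ᵥ cluster i (A *ᵥ η)) -
          σ i * (cluster i η ⬝ᵥ R i *ᵥ cluster i η)) := by
  have h1 : blockDiagonal' R * scalarBlocks n ψ = blockDiagonal' fun i => ψ i • R i := by
    rw [scalarBlocks, ← blockDiagonal'_mul]
    simp
  have h2 : scalarBlocks n σ * blockDiagonal' R * scalarBlocks n ψ =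
      blockDiagonal' fun i => (ψ i * σ i) • R i := by
    rw [mul_assoc, h1, scalarBlocks, ← blockDiagonal'_mul]
    simp [smul_smul, mul_comm]
  have h3 : η ⬝ᵥ He (blockDiagonal' R * scalarBlocks n ψ * A) *ᵥ η =
      ∑ i, ψ i * (2 * (cluster i η ⬝ᵥ R i *ᵥ cluster i (A *ᵥ η))) := by
    rw [He, add_mulVec, dotProduct_add, dotProduct_transpose_mulVec_comm, h1, ← mulVec_mulVec,
      dotProduct_blockDiagonal'_mulVec, ← two_mul, Finset.mul_sum]
    refine Finset.sum_congr rfl fun i _ => ?_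
    rw [smul_mulVec, dotProduct_smul, smul_eq_mul]
    ring
  have h4 : η ⬝ᵥ (scalarBlocks n σ * blockDiagonal' R * scalarBlocks n ψ) *ᵥ η =
      ∑ i, ψ i * (σ i * (cluster i η ⬝ᵥ R i *ᵥ cluster i η)) := by
    rw [h2, dotProduct_blockDiagonal'_mulVec]
    refine Finset.sum_congr rfl fun i _ => ?_
    rw [smul_mulVec, dotProduct_smul, smul_eq_mul, mul_assoc]
  have h5 : ξ ⬝ᵥ He (A * W + B * Y) *ᵥ ξ = 2 * (ξ ⬝ᵥ (A *ᵥ W *ᵥ ξ + B *ᵥ Y *ᵥ ξ)) := by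
    rw [He, add_mulVec, dotProduct_add, dotProduct_transpose_mulVec_comm, add_mulVec,
      mulVec_mulVec, mulVec_mulVec, two_mul]
  simp only [mul_sub, Finset.sum_sub_distrib, ← h3, ← h4]
  simp only [designMatrix, fromBlocks_mulVec, Sum.elim_comp_inl, Sum.elim_comp_inr,
    ← Sum.elim_add_add, sumElim_dotProduct_sumElim, fromBlocks_transpose, transpose_sub,
    transpose_transpose, transpose_zero, transpose_smul, transpose_one, sub_mulVec, neg_mulVec,
    smul_mulVec, zero_mulVec, one_mulVec, dotProduct_add, dotProduct_sub, dotProduct_neg,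
    dotProduct_smul, dotProduct_zero, h5, transpose_neg]
  simp only [dotProduct_transpose_mulVec_comm, ← mulVec_mulVec, smul_eq_mul, dotProduct_comm η v]
  ring

/-- The inclusion inequality bounds `(Z W⁻¹ x_p)_i` by the saturation level where
`x_pᵀ W⁻¹ x_p ≤ μ`; the vector `ξ` stands for `W⁻¹ x_p`. -/
theorem abs_mulVec_le_of_inclusionMatrix {W Rhat : Matrix (PlantIdx n) (PlantIdx n) ℝ}
    {z ξ : PlantIdx n → ℝ} {u μ : ℝ} (hu : 0 ≤ u) (hμ : 0 < μ)
    (h : (inclusionMatrix W Rhat z (u ^ 2 / μ)).PosSemidef) (hξ : ξ ⬝ᵥ W *ᵥ ξ ≤ μ) :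
    |z ⬝ᵥ ξ| ≤ u := by
  set a := z ⬝ᵥ ξ with ha
  -- the choice `-a / μ` minimizes the resulting quadratic polynomial when `ξᵀ W ξ = μ`
  have h1 := h.dotProduct_mulVec_nonneg (Sum.elim (Sum.elim ((-a / μ) • ξ) 0) fun _ => 1)
  have h2 : (-a / μ) * ((-a / μ) * (ξ ⬝ᵥ W *ᵥ ξ)) + 2 * (-a / μ) * a + u ^ 2 / μ =
      star (Sum.elim (Sum.elim ((-a / μ) • ξ) 0) fun _ => (1 : ℝ)) ⬝ᵥ
        inclusionMatrix W Rhat z (u ^ 2 / μ) *ᵥ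
          (Sum.elim (Sum.elim ((-a / μ) • ξ) 0) fun _ => (1 : ℝ)) := by
    have e1 : replicateCol Unit (Sum.elim z (0 : PlantIdx n → ℝ)) *ᵥ (fun _ => (1 : ℝ)) =
        Sum.elim z 0 := by
      ext k
      simp [mulVec, dotProduct]
    have e2 : replicateRow Unit (Sum.elim z (0 : PlantIdx n → ℝ)) *ᵥ
        Sum.elim ((-a / μ) • ξ) 0 = fun _ => (-a / μ) * a := by
      ext k
      change Sum.elim z (0 : PlantIdx n → ℝ) ⬝ᵥ Sum.elim ((-a / μ) • ξ) 0 = _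
      simp [ha]
    have e3 : (of fun _ _ => u ^ 2 / μ : Matrix Unit Unit ℝ) *ᵥ (fun _ => (1 : ℝ)) =
        fun _ => u ^ 2 / μ := by
      ext k
      simp [mulVec, dotProduct]
    have e4 : (fun _ => 1 : Unit → ℝ) ⬝ᵥ ((fun _ => (-a / μ) * a) + fun _ => u ^ 2 / μ) =
        (-a / μ) * a + u ^ 2 / μ := by
      simp [dotProduct]
    have e5 : ξ ⬝ᵥ z = a := dotProduct_comm _ _
    simp only [star_trivial, inclusionMatrix, fromBlocks_mulVec, Sum.elim_comp_inl,
      Sum.elim_comp_inr, e1, e2, e3, sumElim_dotProduct_sumElim, e4, ← Sum.elim_add_add,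
      zero_mulVec, mulVec_zero, add_zero, zero_dotProduct, dotProduct_add, smul_dotProduct,
      mulVec_smul, dotProduct_smul, smul_eq_mul, e5]
    ring
  rw [← h2] at h1
  have h3 : (-a / μ) * ((-a / μ) * (ξ ⬝ᵥ W *ᵥ ξ)) ≤ (-a / μ) * ((-a / μ) * μ) := by
    rw [← mul_assoc, ← mul_assoc]
    exact mul_le_mul_of_nonneg_left hξ (mul_self_nonneg _)
  have h4 : (-a / μ) * ((-a / μ) * μ) + 2 * (-a / μ) * a + u ^ 2 / μ = (u ^ 2 - a ^ 2) / μ := by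
    field_simp
    ring
  have h5 : 0 ≤ (u ^ 2 - a ^ 2) / μ := by linarith
  have h6 := (div_nonneg_iff.1 h5).resolve_right fun h => absurd h.2 hμ.not_ge
  exact abs_le_of_sq_le_sq (by linarith [h6.1]) hu

/-- An affine function of `ψ` is bounded, on the box of the `ψ` with `1 ≤ ψ_i ≤ e_i`, by its value at
some vertex. -/
theorem exists_vertex_sum_le {e ψ c : Fin q → ℝ} (hψ : ∀ i, ψ i ∈ Icc 1 (e i)) :
    ∃ v : Fin q → Bool, ∑ i, ψ i * c i ≤ ∑ i, (if v i then e i else 1) * c i := by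
  refine ⟨fun i => decide (0 ≤ c i), Finset.sum_le_sum fun i _ => ?_⟩
  by_cases hc : 0 ≤ c i
  · simpa [hc] using mul_le_mul_of_nonneg_right (hψ i).2 hc
  · simpa [hc] using mul_le_mul_of_nonpos_right (hψ i).1 (not_le.1 hc).le

theorem exp_mem_Icc {T₂ σ τ : Fin q → ℝ} (hσ : ∀ i, 0 < σ i) (hτ : τ ∈ timerSet T₂) (i : Fin q) :
    Real.exp (σ i * τ i) ∈ Icc 1 (Real.exp (σ i * T₂ i)) :=
  ⟨Real.one_le_exp (mul_nonneg (hσ i).le (hτ i).1),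
    Real.exp_le_exp.2 (mul_le_mul_of_nonneg_left (hτ i).2 (hσ i).le)⟩

theorem cluster_dotProduct_mulVec_nonneg {R : (i : Fin q) → Matrix (Fin (n i)) (Fin (n i)) ℝ}
    (hR : ∀ i, (R i).PosDef) (η : PlantIdx n → ℝ) (i : Fin q) :
    0 ≤ cluster i η ⬝ᵥ R i *ᵥ cluster i η := by
  simpa using (hR i).posSemidef.dotProduct_mulVec_nonneg (cluster i η)

theorem dotProduct_self_eq_sum_cluster (η : PlantIdx n → ℝ) :
    η ⬝ᵥ η = ∑ i, cluster i η ⬝ᵥ cluster i η := by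
  simp only [dotProduct, Fintype.sum_sigma]
  rfl

theorem exists_sum_exp_le {T₂ σ : Fin q → ℝ}
    {R : (i : Fin q) → Matrix (Fin (n i)) (Fin (n i)) ℝ}
    (hσ : ∀ i, 0 < σ i) (hR : ∀ i, (R i).PosDef) :
    ∃ b > 0, ∀ τ ∈ timerSet T₂, ∀ η : PlantIdx n → ℝ,
      ∑ i, Real.exp (σ i * τ i) * (cluster i η ⬝ᵥ R i *ᵥ cluster i η) ≤ b * (η ⬝ᵥ η) := by
  obtain ⟨b, hb, h⟩ :=
    exists_le_mul_dotProduct (blockDiagonal' fun i => Real.exp (σ i * T₂ i) • R i)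
  refine ⟨b, hb, fun τ hτ η => le_trans (Finset.sum_le_sum fun i _ => ?_) ((h η).trans' (le_of_eq
    (dotProduct_blockDiagonal'_mulVec _ η η).symm))⟩
  rw [smul_mulVec, dotProduct_smul, smul_eq_mul]
  exact mul_le_mul_of_nonneg_right (exp_mem_Icc hσ hτ i).2 (cluster_dotProduct_mulVec_nonneg hR η i)

theorem exists_lyapunov_bounds {T₂ σ : Fin q → ℝ} {W : Matrix (PlantIdx n) (PlantIdx n) ℝ}
    {R : (i : Fin q) → Matrix (Fin (n i)) (Fin (n i)) ℝ}
    (hσ : ∀ i, 0 < σ i) (hW : W.PosDef) (hR : ∀ i, (R i).PosDef) :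
    ∃ a > 0, ∃ b > 0, ∀ τ ∈ timerSet T₂, ∀ p η : PlantIdx n → ℝ,
      a * (p ⬝ᵥ p + η ⬝ᵥ η) ≤ lyapunov W R σ p η τ ∧
        lyapunov W R σ p η τ ≤ b * (p ⬝ᵥ p + η ⬝ᵥ η) := by
  obtain ⟨a₁, ha₁, h₁⟩ := exists_pos_mul_dotProduct_le hW.inv
  obtain ⟨b₁, hb₁, h₂⟩ := exists_le_mul_dotProduct W⁻¹
  obtain ⟨b₂, hb₂, h₃⟩ := exists_sum_exp_le (T₂ := T₂) hσ hR
  choose c hc h₄ using fun i => exists_pos_mul_dotProduct_le (hR i)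
  obtain ⟨a₂, ha₂, h₅⟩ : ∃ a₂ > 0, ∀ i, a₂ ≤ c i := by
    rcases isEmpty_or_nonempty (Fin q) with he | hne
    · exact ⟨1, one_pos, fun i => he.elim i⟩
    · obtain ⟨i, hi⟩ := Finite.exists_min c
      exact ⟨c i, hc i, hi⟩
  have hnn : ∀ v : PlantIdx n → ℝ, 0 ≤ v ⬝ᵥ v := fun v => Finset.sum_nonneg fun i _ =>
    mul_self_nonneg _
  refine ⟨min a₁ a₂, lt_min ha₁ ha₂, b₁ + b₂, add_pos hb₁ hb₂, fun τ hτ p η => ⟨?_, ?_⟩⟩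
  · have h6 : a₂ * (η ⬝ᵥ η) ≤
        ∑ i, Real.exp (σ i * τ i) * (cluster i η ⬝ᵥ R i *ᵥ cluster i η) := by
      rw [dotProduct_self_eq_sum_cluster, Finset.mul_sum]
      refine Finset.sum_le_sum fun i _ => ?_
      have h7 : 0 ≤ cluster i η ⬝ᵥ cluster i η := Finset.sum_nonneg fun i _ => mul_self_nonneg _
      calc a₂ * (cluster i η ⬝ᵥ cluster i η) ≤ c i * (cluster i η ⬝ᵥ cluster i η) := by
            gcongr
            exact h₅ i
        _ ≤ cluster i η ⬝ᵥ R i *ᵥ cluster i η := h₄ i _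
        _ ≤ Real.exp (σ i * τ i) * (cluster i η ⬝ᵥ R i *ᵥ cluster i η) :=
            le_mul_of_one_le_left (cluster_dotProduct_mulVec_nonneg hR η i) (exp_mem_Icc hσ hτ i).1
    have h8 : min a₁ a₂ * (p ⬝ᵥ p) ≤ a₁ * (p ⬝ᵥ p) :=
      mul_le_mul_of_nonneg_right (min_le_left _ _) (hnn p)
    have h9 : min a₁ a₂ * (η ⬝ᵥ η) ≤ a₂ * (η ⬝ᵥ η) :=
      mul_le_mul_of_nonneg_right (min_le_right _ _) (hnn η)
    rw [lyapunov, mul_add]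
    linarith [h₁ p]
  · have h6 := h₂ p
    have h7 := h₃ τ hτ η
    rw [lyapunov]
    nlinarith [mul_nonneg hb₂.le (hnn p), mul_nonneg hb₁.le (hnn η)]

/-- The derivative of the Lyapunov function along the flow is at most `-c` times the Lyapunov
function wherever the latter is at most `μbar`. With `ξ = W⁻¹ x_p`, `v = W⁻¹ η̃` and `s = S⁻¹ dz`,
this derivative is the quadratic form of the design matrix at `(ξ, v, s, η̃)`, plus a term that the
sector condition makes nonpositive. -/
theorem exists_lyapunov_decay (A : Matrix (PlantIdx n) (PlantIdx n) ℝ)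
    (B : Matrix (PlantIdx n) (Fin m) ℝ) {ubar : Fin m → ℝ} (hubar : ∀ i, 0 < ubar i)
    {T₂ : Fin q → ℝ} {W : Matrix (PlantIdx n) (PlantIdx n) ℝ} (hW : W.PosDef)
    {Y Z : Matrix (Fin m) (PlantIdx n) ℝ}
    {R : (i : Fin q) → Matrix (Fin (n i)) (Fin (n i)) ℝ} (hR : ∀ i, (R i).PosDef)
    {S : Matrix (Fin m) (Fin m) ℝ} (hSdiag : S.IsDiag) (hS : S.PosDef)
    {σ : Fin q → ℝ} (hσ : ∀ i, 0 < σ i) {μbar α : ℝ} (hμbar : 0 < μbar)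
    (hincl : ∀ i : Fin m,
      (inclusionMatrix W (blockDiagonal' R) (Z i) (ubar i ^ 2 / μbar)).PosSemidef)
    (hdes : ∀ Ψ ∈ vertices n σ T₂,
      (-designMatrix A B W (blockDiagonal' R) (scalarBlocks n σ) Ψ Y Z S α).PosDef) :
    ∃ c > 0, ∀ τ ∈ timerSet T₂, ∀ p η : PlantIdx n → ℝ, lyapunov W R σ p η τ ≤ μbar →
      2 * (p ⬝ᵥ W⁻¹ *ᵥ (A *ᵥ p + B *ᵥ (Y * W⁻¹) *ᵥ p - B *ᵥ (Y * W⁻¹) *ᵥ η +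
          B *ᵥ dz ubar ((Y * W⁻¹) *ᵥ p - (Y * W⁻¹) *ᵥ η))) +
        ∑ i, Real.exp (σ i * τ i) * (2 * (cluster i η ⬝ᵥ R i *ᵥ cluster i (A *ᵥ η)) -
          σ i * (cluster i η ⬝ᵥ R i *ᵥ cluster i η)) ≤
      -c * lyapunov W R σ p η τ := by
  have hdet : IsUnit W.det := hW.det_pos.ne'.isUnit
  have hWt : Wᵀ = W := by simpa using hW.isHermitian.eq
  have hnn : ∀ {ι : Type} [Fintype ι] (v : ι → ℝ), 0 ≤ v ⬝ᵥ v := fun v =>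
    Finset.sum_nonneg fun i _ => mul_self_nonneg _
  choose c hc hcle using fun v : Fin q → Bool => exists_pos_mul_dotProduct_le
    (hdes _ ⟨fun i => if v i then Real.exp (σ i * T₂ i) else 1, fun i => by
      by_cases h : v i <;> simp [h], rfl⟩)
  obtain ⟨v₀, hv₀⟩ := Finite.exists_min c
  obtain ⟨b₁, hb₁, hb₁le⟩ := exists_le_mul_dotProduct W
  obtain ⟨b₂, hb₂, hb₂le⟩ := exists_sum_exp_le (T₂ := T₂) hσ hR
  refine ⟨c v₀ / (b₁ + b₂), div_pos (hc v₀) (add_pos hb₁ hb₂), fun τ hτ p η hV => ?_⟩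
  set ξ := W⁻¹ *ᵥ p with hξ
  set v := W⁻¹ *ᵥ η with hv
  have hWξ : W *ᵥ ξ = p := by rw [hξ, mulVec_mulVec, mul_nonsing_inv _ hdet, one_mulVec]
  have hWv : W *ᵥ v = η := by rw [hv, mulVec_mulVec, mul_nonsing_inv _ hdet, one_mulVec]
  have hY : ∀ x, (Y * W⁻¹) *ᵥ x = Y *ᵥ W⁻¹ *ᵥ x := fun x => (mulVec_mulVec _ _ _).symm
  rw [hY, hY, ← hξ, ← hv]
  set w := dz ubar (Y *ᵥ ξ - Y *ᵥ v) with hw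
  have hSpos : ∀ i, 0 < S i i := fun i => hS.diag_pos
  set s : Fin m → ℝ := fun i => w i / S i i with hs
  have hSs : S *ᵥ s = w := by
    ext i
    rw [mulVec, dotProduct, Finset.sum_eq_single i]
    · exact mul_div_cancel₀ _ (hSpos i).ne'
    · intro j _ hj
      rw [hSdiag hj.symm, zero_mul]
    · simp
  have hpξ : p ⬝ᵥ W⁻¹ *ᵥ p = ξ ⬝ᵥ W *ᵥ ξ := by rw [hWξ, dotProduct_comm]
  have hswap : ∀ x, p ⬝ᵥ W⁻¹ *ᵥ x = ξ ⬝ᵥ x := fun x => by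
    have h := dotProduct_transpose_mulVec_comm W⁻¹ p x
    rw [transpose_nonsing_inv, hWt] at h
    rw [h, dotProduct_comm]
  have hsum0 : 0 ≤ ∑ i, Real.exp (σ i * τ i) * (cluster i η ⬝ᵥ R i *ᵥ cluster i η) :=
    Finset.sum_nonneg fun i _ =>
      mul_nonneg (Real.exp_pos _).le (cluster_dotProduct_mulVec_nonneg hR η i)
  have hξμ : ξ ⬝ᵥ W *ᵥ ξ ≤ μbar := by
    rw [lyapunov] at hV
    linarith
  have hsector : s ⬝ᵥ (S *ᵥ s + (Y *ᵥ ξ - Y *ᵥ v) + Z *ᵥ ξ) ≤ 0 := by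
    rw [hSs]
    refine Finset.sum_nonpos fun i _ => ?_
    have h1 : |(Z *ᵥ ξ) i| ≤ ubar i :=
      abs_mulVec_le_of_inclusionMatrix (hubar i).le hμbar (hincl i) hξμ
    have h2 := dz_mul_add_nonpos h1 (Y *ᵥ ξ - Y *ᵥ v)
    have h3 : s i * (w + (Y *ᵥ ξ - Y *ᵥ v) + Z *ᵥ ξ) i =
        (w i * (w i + (Y *ᵥ ξ - Y *ᵥ v) i + (Z *ᵥ ξ) i)) / S i i := by
      simp only [hs, Pi.add_apply]
      ring
    rw [h3]
    exact div_nonpos_of_nonpos_of_nonneg h2 (hSpos i).le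
  obtain ⟨ε, hε⟩ := exists_vertex_sum_le (exp_mem_Icc hσ hτ) (c := fun i =>
    2 * (cluster i η ⬝ᵥ R i *ᵥ cluster i (A *ᵥ η)) - σ i * (cluster i η ⬝ᵥ R i *ᵥ cluster i η))
  have hform := hcle ε (Sum.elim (Sum.elim ξ v) (Sum.elim s η))
  rw [neg_mulVec, dotProduct_neg, dotProduct_designMatrix_mulVec, hWξ, hWv, sub_self,
    dotProduct_zero, mul_zero, add_zero, sumElim_dotProduct_sumElim, sumElim_dotProduct_sumElim,
    sumElim_dotProduct_sumElim] at hform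
  have hlow : c v₀ * (ξ ⬝ᵥ ξ + η ⬝ᵥ η) ≤ c ε * (ξ ⬝ᵥ ξ + v ⬝ᵥ v + (s ⬝ᵥ s + η ⬝ᵥ η)) :=
    mul_le_mul (hv₀ ε) (by linarith [hnn v, hnn s]) (add_nonneg (hnn ξ) (hnn η)) (hc ε).le
  have hVle : lyapunov W R σ p η τ ≤ (b₁ + b₂) * (ξ ⬝ᵥ ξ + η ⬝ᵥ η) := by
    have h1 := hb₁le ξ
    have h2 := hb₂le τ hτ η
    rw [lyapunov, hpξ]
    nlinarith [mul_nonneg hb₂.le (hnn ξ), mul_nonneg hb₁.le (hnn η)]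
  have hfin : c v₀ / (b₁ + b₂) * lyapunov W R σ p η τ ≤ c v₀ * (ξ ⬝ᵥ ξ + η ⬝ᵥ η) := by
    rw [div_mul_eq_mul_div, div_le_iff₀ (add_pos hb₁ hb₂), mul_assoc, mul_comm _ (b₁ + b₂)]
    exact mul_le_mul_of_nonneg_left hVle (hc v₀).le
  rw [hSs] at hform hsector
  rw [hswap]
  linarith

end Lyapunov

/-! ### Solutions of the closed loop -/

theorem le_mul_exp_of_hasDerivWithinAt {v v' : ℝ → ℝ} {a b c μ : ℝ} (hc : 0 < c) (hμ : 0 < μ)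
    (hab : a ≤ b) (hv : ∀ t ∈ Icc a b, HasDerivWithinAt v (v' t) (Icc a b) t) (ha : v a ≤ μ)
    (hdecay : ∀ t ∈ Icc a b, v t ≤ μ → v' t ≤ -c * v t) : v b ≤ v a * Real.exp (-c * (b - a)) := by
  have hcont : ContinuousOn v (Icc a b) := fun t ht => (hv t ht).continuousWithinAt
  have hr : ∀ t ∈ Ico a b, HasDerivWithinAt v (v' t) (Ici t) t := fun t ht =>
    (hv t (Ico_subset_Icc_self ht)).mono_of_mem_nhdsWithin (Icc_mem_nhdsGE_of_mem ht)
  -- `v` cannot cross the level `μ`, where its derivative is negative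
  have hle : ∀ t ∈ Icc a b, v t ≤ μ := by
    refine image_le_of_deriv_right_lt_deriv_boundary hcont hr ha (fun t => hasDerivAt_const t μ)
      fun t ht hvt => ?_
    have := hdecay t (Ico_subset_Icc_self ht) hvt.le
    rw [hvt] at this
    nlinarith
  have hexp : ∀ t, HasDerivAt (fun r => Real.exp (c * (r - a))) (Real.exp (c * (t - a)) * c) t := by
    intro t
    simpa using (((hasDerivAt_id t).sub_const a).const_mul c).exp
  have h := image_le_of_deriv_right_le_deriv_boundary (f := fun t => v t * Real.exp (c * (t - a)))
    (B := fun _ => v a) (B' := fun _ => 0) (a := a) (b := b)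
    (hcont.mul (fun t _ => (hexp t).continuousAt.continuousWithinAt))
    (fun t ht => (hr t ht).mul (hexp t).hasDerivWithinAt) (by simp) continuousOn_const
    (fun t _ => hasDerivWithinAt_const t _ _) (fun t ht => by
      have h1 := hdecay t (Ico_subset_Icc_self ht) (hle t (Ico_subset_Icc_self ht))
      nlinarith [Real.exp_pos (c * (t - a))]) (right_mem_Icc.2 hab)
  have he : Real.exp (c * (b - a)) * Real.exp (-c * (b - a)) = 1 := by
    rw [← Real.exp_add]
    simp
  calc v b = v b * Real.exp (c * (b - a)) * Real.exp (-c * (b - a)) := by rw [mul_assoc, he, mul_one]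
    _ ≤ v a * Real.exp (-c * (b - a)) := mul_le_mul_of_nonneg_right h (Real.exp_pos _).le

section ClosedLoop

variable {q m : ℕ} {n : Fin q → ℕ}

theorem State.bar_eq (x : State n) : x.bar = Sum.elim x.plant x.err := by
  ext (k | k) <;> rfl

theorem infDist_attractor {T₂ : Fin q → ℝ} {x : State n} (hx : x.timer ∈ timerSet T₂) :
    Metric.infDist x (attractor n T₂) = √(x.plant ⬝ᵥ x.plant + x.err ⬝ᵥ x.err) := by
  set y : State n := WithLp.toLp 2 (Sum.elim 0 x.timer) with hy
  have hyA : y ∈ attractor n T₂ := ⟨by ext k; rfl, hx⟩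
  have hbar : x.plant ⬝ᵥ x.plant + x.err ⬝ᵥ x.err = ∑ k, (x.bar k) ^ 2 := by
    simp [State.bar_eq, dotProduct, sq]
  rw [hbar]
  refine le_antisymm ((Metric.infDist_le_dist_of_mem hyA).trans (le_of_eq ?_))
    ((Metric.le_infDist ⟨y, hyA⟩).2 fun z hz => ?_)
  · rw [EuclideanSpace.dist_eq, Fintype.sum_sum_type]
    simp [hy, State.bar, State.timer]
  · rw [EuclideanSpace.dist_eq]
    refine Real.sqrt_le_sqrt ?_
    have h0 : ∀ k, z (Sum.inl k) = 0 := fun k => congrFun hz.1 k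
    have h1 : ∑ k, dist (x (Sum.inl k)) (z (Sum.inl k)) ^ 2 = ∑ k, x.bar k ^ 2 :=
      Finset.sum_congr rfl fun k _ => by rw [h0, Real.dist_eq, sub_zero, sq_abs]; rfl
    rw [Fintype.sum_sum_type fun k => dist (x k) (z k) ^ 2, h1]
    exact le_add_of_nonneg_right (Finset.sum_nonneg fun i _ => sq_nonneg _)

variable {A : Matrix (PlantIdx n) (PlantIdx n) ℝ} {B : Matrix (PlantIdx n) (Fin m) ℝ}
  {ubar : Fin m → ℝ} {T₁ T₂ : Fin q → ℝ} {K : Matrix (Fin m) (PlantIdx n) ℝ}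

theorem closedLoop_f_timer (x : State n) (i : Fin q) :
    (closedLoop A B ubar T₁ T₂ K).f x (Sum.inr i) = -1 := rfl

theorem closedLoop_f_bar (x : State n) : State.bar ((closedLoop A B ubar T₁ T₂ K).f x) =
    Acl A B K *ᵥ x.bar + Bcl B *ᵥ dz ubar (Kcl K *ᵥ x.bar) := rfl

theorem closedLoop_f_eq_elim (x : State n) :
    State.bar ((closedLoop A B ubar T₁ T₂ K).f x) =
      Sum.elim (A *ᵥ x.plant + B *ᵥ K *ᵥ x.plant - B *ᵥ K *ᵥ x.err +
        B *ᵥ dz ubar (K *ᵥ x.plant - K *ᵥ x.err)) (A *ᵥ x.err) := by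
  rw [closedLoop_f_bar, State.bar_eq, Acl, Bcl, Kcl, fromBlocks_mulVec, fromRows_mulVec,
    fromCols_mulVec]
  simp only [Sum.elim_comp_inl, Sum.elim_comp_inr, neg_mulVec, add_mulVec, zero_mulVec,
    ← mulVec_mulVec, zero_add, ← sub_eq_add_neg, ← Sum.elim_add_add, add_zero]

theorem closedLoop_f_plant (x : State n) : State.plant ((closedLoop A B ubar T₁ T₂ K).f x) =
    A *ᵥ x.plant + B *ᵥ K *ᵥ x.plant - B *ᵥ K *ᵥ x.err +
      B *ᵥ dz ubar (K *ᵥ x.plant - K *ᵥ x.err) :=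
  funext fun k => congrFun (closedLoop_f_eq_elim x) (Sum.inl k)

theorem closedLoop_f_err (x : State n) :
    State.err ((closedLoop A B ubar T₁ T₂ K).f x) = A *ᵥ x.err :=
  funext fun k => congrFun (closedLoop_f_eq_elim x) (Sum.inr k)

theorem exists_lipschitzWith_mulVec {ι κ : Type*} [Fintype ι] [Fintype κ] (M : Matrix ι κ ℝ) :
    ∃ C, LipschitzWith C fun x : κ → ℝ => M *ᵥ x :=
  ⟨_, (LinearMap.toContinuousLinearMap M.mulVecLin).lipschitz⟩

theorem exists_lipschitzWith_closedLoop_f (hubar : ∀ i, 0 < ubar i) :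
    ∃ C, LipschitzWith C (closedLoop A B ubar T₁ T₂ K).f := by
  obtain ⟨C₁, h₁⟩ := exists_lipschitzWith_mulVec (Acl A B K)
  obtain ⟨C₂, h₂⟩ := exists_lipschitzWith_mulVec (Bcl B)
  obtain ⟨C₃, h₃⟩ := exists_lipschitzWith_mulVec (Kcl K)
  have hbar : LipschitzWith 1 fun x : State n => x.bar := by
    refine LipschitzWith.of_dist_le_mul fun x y => ?_
    rw [NNReal.coe_one, one_mul, dist_pi_le_iff dist_nonneg]
    intro k
    rw [dist_eq_norm, dist_eq_norm]
    exact PiLp.norm_apply_le (x - y) (Sum.inl k)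
  have helim : LipschitzWith 1 fun v : PlantIdx n ⊕ PlantIdx n → ℝ =>
      (Sum.elim v (fun _ => -1) : (PlantIdx n ⊕ PlantIdx n) ⊕ Fin q → ℝ) := by
    refine LipschitzWith.of_dist_le_mul fun x y => ?_
    rw [NNReal.coe_one, one_mul, dist_pi_le_iff dist_nonneg]
    rintro (k | k)
    · exact dist_le_pi_dist x y k
    · simp
  exact ⟨_, (PiLp.lipschitzWith_toLp 2 _).comp (helim.comp
    ((h₁.comp hbar).add (h₂.comp ((lipschitzWith_dz hubar).comp (h₃.comp hbar)))))⟩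

theorem isClosed_timer_mem_timerSet (T₂ : Fin q → ℝ) :
    IsClosed {x : State n | x.timer ∈ timerSet T₂} := by
  have h : {x : State n | x.timer ∈ timerSet T₂} =
      ⋂ i, {x : State n | x (Sum.inr i) ∈ Icc 0 (T₂ i)} := by
    ext x
    simp [timerSet, State.timer]
  rw [h]
  exact isClosed_iInter fun i => isClosed_Icc.preimage (by fun_prop)

theorem hasDerivWithinAt_apply {y : ℝ → State n} {y' : State n} {s : Set ℝ} {t : ℝ}
    (h : HasDerivWithinAt y y' s t) (k : (PlantIdx n ⊕ PlantIdx n) ⊕ Fin q) :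
    HasDerivWithinAt (fun r => y r k) (y' k) s t :=
  (EuclideanSpace.proj k : State n →L[ℝ] ℝ).hasFDerivAt.comp_hasDerivWithinAt t h

/-- The timers count down during flow. -/
theorem timer_eq_sub {y : ℝ → State n} {a b : ℝ} (hab : a ≤ b)
    (hy : ∀ t ∈ Icc a b,
      HasDerivWithinAt y ((closedLoop A B ubar T₁ T₂ K).f (y t)) (Icc a b) t) (i : Fin q) :
    (y b).timer i = (y a).timer i - (b - a) := by
  have hd : ∀ t ∈ Icc a b, HasDerivWithinAt (fun r => y r (Sum.inr i) + r) 0 (Icc a b) t := by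
    intro t ht
    have := (hasDerivWithinAt_apply (hy t ht) (Sum.inr i)).add (hasDerivWithinAt_id t _)
    rwa [closedLoop_f_timer, neg_add_cancel] at this
  have h := constant_of_has_deriv_right_zero (fun t ht => (hd t ht).continuousWithinAt)
    (fun t ht => (hd t (Ico_subset_Icc_self ht)).mono_of_mem_nhdsWithin
      (Icc_mem_nhdsGE_of_mem ht)) b (right_mem_Icc.2 hab)
  have h' : y b (Sum.inr i) + b = y a (Sum.inr i) + a := h
  change y b (Sum.inr i) = y a (Sum.inr i) - (b - a)
  linarith

theorem hasDerivWithinAt_lyapunov {W : Matrix (PlantIdx n) (PlantIdx n) ℝ} (hW : W.PosDef)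
    {R : (i : Fin q) → Matrix (Fin (n i)) (Fin (n i)) ℝ} (hR : ∀ i, (R i).PosDef) (σ : Fin q → ℝ)
    {y : ℝ → State n} {s : Set ℝ} {t : ℝ}
    (hy : HasDerivWithinAt y ((closedLoop A B ubar T₁ T₂ K).f (y t)) s t) :
    HasDerivWithinAt (fun r => lyapunov W R σ (y r).plant (y r).err (y r).timer)
      (2 * ((y t).plant ⬝ᵥ W⁻¹ *ᵥ (A *ᵥ (y t).plant + B *ᵥ K *ᵥ (y t).plant - B *ᵥ K *ᵥ (y t).err +
          B *ᵥ dz ubar (K *ᵥ (y t).plant - K *ᵥ (y t).err))) +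
        ∑ i, Real.exp (σ i * (y t).timer i) *
          (2 * (cluster i (y t).err ⬝ᵥ R i *ᵥ cluster i (A *ᵥ (y t).err)) -
          σ i * (cluster i (y t).err ⬝ᵥ R i *ᵥ cluster i (y t).err))) s t := by
  have hWt : W⁻¹ᵀ = W⁻¹ := by simpa using hW.inv.isHermitian.eq
  have h1 := hasDerivWithinAt_dotProduct_mulVec_self (u := fun r => (y r).plant) hWt
    fun k => hasDerivWithinAt_apply hy (Sum.inl (Sum.inl k))
  have h2 : ∀ i, HasDerivWithinAt (fun r => Real.exp (σ i * (y r).timer i) *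
      (cluster i (y r).err ⬝ᵥ R i *ᵥ cluster i (y r).err))
      (Real.exp (σ i * (y t).timer i) * (2 * (cluster i (y t).err ⬝ᵥ R i *ᵥ cluster i (A *ᵥ (y t).err)) -
          σ i * (cluster i (y t).err ⬝ᵥ R i *ᵥ cluster i (y t).err))) s t := by
    intro i
    have hRt : (R i)ᵀ = R i := by simpa using (hR i).isHermitian.eq
    have h3 := hasDerivWithinAt_dotProduct_mulVec_self (u := fun r => cluster i (y r).err) hRt
      fun k => hasDerivWithinAt_apply hy (Sum.inl (Sum.inr ⟨i, k⟩))
    have h4 := ((hasDerivWithinAt_apply hy (Sum.inr i)).const_mul (σ i)).exp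
    refine (h4.mul h3).congr_deriv ?_
    have h5 : (fun k => (closedLoop A B ubar T₁ T₂ K).f (y t) (Sum.inl (Sum.inr ⟨i, k⟩))) =
        cluster i (A *ᵥ (y t).err) := by
      rw [← closedLoop_f_err (B := B) (ubar := ubar) (T₁ := T₁) (T₂ := T₂) (K := K)]
      rfl
    rw [h5, closedLoop_f_timer]
    simp only [State.timer]
    ring
  refine (h1.add (HasDerivWithinAt.fun_sum fun i _ => h2 i)).congr_deriv ?_
  rw [← closedLoop_f_plant (T₁ := T₁) (T₂ := T₂)]
  rfl

/-- A jump sets one term of the Lyapunov function to zero and leaves the other ones unchanged. -/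
theorem lyapunov_jump_le {W : Matrix (PlantIdx n) (PlantIdx n) ℝ}
    {R : (i : Fin q) → Matrix (Fin (n i)) (Fin (n i)) ℝ} (hR : ∀ i, (R i).PosDef) (σ : Fin q → ℝ)
    {i : Fin q} {p η : PlantIdx n → ℝ} {τ χ : Fin q → ℝ} (hχ : ∀ k, k ≠ i → χ k = τ k) :
    lyapunov W R σ p (resetErr i η) χ ≤ lyapunov W R σ p η τ := by
  have hcl : ∀ k, cluster k (resetErr i η) = if k = i then 0 else cluster k η := by
    intro k
    ext l
    simp only [cluster, resetErr, mulVec, dotProduct, Fintype.sum_sigma]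
    rw [Finset.sum_eq_single k]
    · by_cases h : k = i
      · simp [blockDiagonal'_apply_eq, h]
      · simp [blockDiagonal'_apply_eq, h, one_apply, cluster]
    · intro j _ hj
      exact Finset.sum_eq_zero fun l _ => by rw [blockDiagonal'_apply_ne _ _ _ hj.symm, zero_mul]
    · simp
  refine add_le_add le_rfl (Finset.sum_le_sum fun k _ => ?_)
  rw [hcl]
  by_cases h : k = i
  · rw [if_pos h]
    simpa using mul_nonneg (Real.exp_pos _).le (cluster_dotProduct_mulVec_nonneg hR η k)
  · simp [h, hχ k h]

end ClosedLoop

/-! ### Invariants and completeness of solutions -/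

section Invariants

variable {q m : ℕ} {n : Fin q → ℕ}
  {A : Matrix (PlantIdx n) (PlantIdx n) ℝ} {B : Matrix (PlantIdx n) (Fin m) ℝ}
  {ubar : Fin m → ℝ} {T₁ T₂ : Fin q → ℝ} {K : Matrix (Fin m) (PlantIdx n) ℝ}
  {W : Matrix (PlantIdx n) (PlantIdx n) ℝ} {R : (i : Fin q) → Matrix (Fin (n i)) (Fin (n i)) ℝ}
  {σ : Fin q → ℝ} {μ c : ℝ} {φ : HybridArc (State n)}

theorem timer_zero_mem (hφ : IsSolution (closedLoop A B ubar T₁ T₂ K) φ) :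
    (φ.toFun 0 0).timer ∈ timerSet T₂ := by
  rcases hφ.initial with h | ⟨i, h⟩
  · have hC : IsClosed (closedLoop A B ubar T₁ T₂ K).C := isClosed_timer_mem_timerSet T₂
    rw [hC.closure_eq] at h
    exact h
  · exact h.1

theorem lyapunov_nonneg (hW : W.PosDef) (hR : ∀ i, (R i).PosDef) (p η : PlantIdx n → ℝ)
    (τ : Fin q → ℝ) : 0 ≤ lyapunov W R σ p η τ :=
  add_nonneg (by simpa using hW.inv.posSemidef.dotProduct_mulVec_nonneg p)
    (Finset.sum_nonneg fun i _ =>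
      mul_nonneg (Real.exp_pos _).le (cluster_dotProduct_mulVec_nonneg hR η i))

/-- The invariants of a solution that starts where the Lyapunov function is at most `μ`: the timers
stay in range, the Lyapunov function decays exponentially in the time of flow, and the number of
jumps is bounded. The last one holds because `∑ (τ_i + t) / T₁⁽ⁱ⁾` is constant during flow and
increases by at least `1` at jumps. -/
theorem IsSolution.invariants (hubar : ∀ i, 0 < ubar i) (hT₁ : ∀ i, 0 < T₁ i)
    (hW : W.PosDef) (hR : ∀ i, (R i).PosDef) (hμ : 0 < μ) (hc : 0 < c)
    (hdecay : ∀ τ ∈ timerSet T₂, ∀ p η : PlantIdx n → ℝ, lyapunov W R σ p η τ ≤ μ →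
      2 * (p ⬝ᵥ W⁻¹ *ᵥ (A *ᵥ p + B *ᵥ K *ᵥ p - B *ᵥ K *ᵥ η + B *ᵥ dz ubar (K *ᵥ p - K *ᵥ η))) +
        ∑ i, Real.exp (σ i * τ i) * (2 * (cluster i η ⬝ᵥ R i *ᵥ cluster i (A *ᵥ η)) -
          σ i * (cluster i η ⬝ᵥ R i *ᵥ cluster i η)) ≤ -c * lyapunov W R σ p η τ)
    (hφ : IsSolution (closedLoop A B ubar T₁ T₂ K) φ)
    (h0 : lyapunov W R σ (φ.toFun 0 0).plant (φ.toFun 0 0).err (φ.toFun 0 0).timer ≤ μ) :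
    ∀ j t, (t, j) ∈ φ.dom → (φ.toFun t j).timer ∈ timerSet T₂ ∧
      lyapunov W R σ (φ.toFun t j).plant (φ.toFun t j).err (φ.toFun t j).timer ≤
        lyapunov W R σ (φ.toFun 0 0).plant (φ.toFun 0 0).err (φ.toFun 0 0).timer *
          Real.exp (-c * t) ∧
      0 ≤ t ∧ (j : ℝ) ≤ ∑ i, ((φ.toFun t j).timer i + t) / T₁ i := by
  obtain ⟨C, hC⟩ := exists_lipschitzWith_closedLoop_f (A := A) (B := B) (T₁ := T₁) (T₂ := T₂)
    (K := K) hubar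
  have hclosed : IsClosed (closedLoop A B ubar T₁ T₂ K).C := isClosed_timer_mem_timerSet T₂
  have ht0 := timer_zero_mem hφ
  refine φ.isHybridTimeDomain.induction ⟨ht0, by simp, le_rfl, ?_⟩ ?_ ?_
  · rw [Nat.cast_zero]
    exact Finset.sum_nonneg fun i _ => div_nonneg (by linarith [(ht0 i).1]) (hT₁ i).le
  · rintro j a b hab ha hb ⟨hτ, hV, h0a, hj⟩
    have hd := hφ.hasDerivWithinAt hC.continuous hab ha hb
    have hmem : ∀ t ∈ Icc a b, (φ.toFun t j).timer ∈ timerSet T₂ := by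
      intro t ht
      rcases hab.eq_or_lt with rfl | hlt
      · rw [Icc_self, mem_singleton_iff] at ht
        rwa [ht]
      · exact hφ.mem_flowSet hclosed hlt ha hb t ht
    have hVa : lyapunov W R σ (φ.toFun a j).plant (φ.toFun a j).err (φ.toFun a j).timer ≤ μ := by
      refine hV.trans ((mul_le_of_le_one_right (lyapunov_nonneg hW hR _ _ _) ?_).trans h0)
      exact Real.exp_le_one_iff.2 (by nlinarith)
    refine ⟨hmem b (right_mem_Icc.2 hab), ?_, h0a.trans hab, ?_⟩
    · have h1 := le_mul_exp_of_hasDerivWithinAt hc hμ hab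
        (fun t ht => hasDerivWithinAt_lyapunov hW hR σ (hd t ht)) hVa
        fun t ht hle => hdecay _ (hmem t ht) _ _ hle
      refine h1.trans ((mul_le_mul_of_nonneg_right hV (Real.exp_pos _).le).trans (le_of_eq ?_))
      rw [mul_assoc, ← Real.exp_add]
      ring_nf
    · refine hj.trans (le_of_eq (Finset.sum_congr rfl fun i _ => ?_))
      rw [timer_eq_sub hab hd i]
      ring
  · rintro j t htj htj' ⟨hτ, hV, h0t, hj⟩
    obtain ⟨-, hp, i, hi, he, hri, hrk⟩ := hφ.jump t j htj htj'
    have hT : T₁ i ≤ (φ.toFun t (j + 1)).timer i := hri.1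
    refine ⟨fun k => ?_, ?_, h0t, ?_⟩
    · rcases eq_or_ne k i with rfl | hk
      · exact ⟨(hT₁ k).le.trans hri.1, hri.2⟩
      · rw [hrk k hk]
        exact hτ k
    · rw [hp, he]
      exact (lyapunov_jump_le hR σ hrk).trans hV
    · have hsum : ∑ k, ((φ.toFun t j).timer k + t) / T₁ k + 1 ≤
          ∑ k, ((φ.toFun t (j + 1)).timer k + t) / T₁ k := by
        rw [← Finset.add_sum_erase _ _ (Finset.mem_univ i),
          ← Finset.add_sum_erase (a := i) _ (fun k => ((φ.toFun t (j + 1)).timer k + t) / T₁ k)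
            (Finset.mem_univ i)]
        have h1 : ∑ k ∈ Finset.univ.erase i, ((φ.toFun t (j + 1)).timer k + t) / T₁ k =
            ∑ k ∈ Finset.univ.erase i, ((φ.toFun t j).timer k + t) / T₁ k :=
          Finset.sum_congr rfl fun k hk => by rw [hrk k (Finset.ne_of_mem_erase hk)]
        have h2 : ((φ.toFun t j).timer i + t) / T₁ i + 1 ≤
            ((φ.toFun t (j + 1)).timer i + t) / T₁ i := by
          have h3 : (φ.toFun t j).timer i = 0 := hi.2
          rw [h3, div_add_one (hT₁ i).ne']
          exact div_le_div_of_nonneg_right (by linarith) (hT₁ i).le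
        linarith
      push_cast
      linarith

/-- A maximal solution of the closed loop along which the plant state and the error stay bounded is
complete. -/
theorem IsMaximalSolution.isComplete_closedLoop (hubar : ∀ i, 0 < ubar i)
    (hT₁₂ : ∀ i, T₁ i ≤ T₂ i) (hφ : IsMaximalSolution (closedLoop A B ubar T₁ T₂ K) φ)
    (hτ : ∀ t j, (t, j) ∈ φ.dom → (φ.toFun t j).timer ∈ timerSet T₂) {r : ℝ}
    (hr : ∀ t j, (t, j) ∈ φ.dom →
      (φ.toFun t j).plant ⬝ᵥ (φ.toFun t j).plant + (φ.toFun t j).err ⬝ᵥ (φ.toFun t j).err ≤ r) :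
    IsComplete φ := by
  obtain ⟨C, hC⟩ := exists_lipschitzWith_closedLoop_f (A := A) (B := B) (T₁ := T₁) (T₂ := T₂)
    (K := K) hubar
  have hG : ∀ x ∈ (closedLoop A B ubar T₁ T₂ K).D,
      ((closedLoop A B ubar T₁ T₂ K).G x).Nonempty := by
    rintro x ⟨i, hi⟩
    refine ⟨WithLp.toLp 2 (Sum.elim (Sum.elim x.plant (resetErr i x.err))
      (Function.update x.timer i (T₁ i))), rfl, i, hi, rfl, ?_, fun k hk => ?_⟩
    · simp [State.timer, hT₁₂ i]
    · simp [State.timer, hk]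
  have hbound : ∀ s j, (s, j) ∈ φ.dom → ‖(closedLoop A B ubar T₁ T₂ K).f (φ.toFun s j)‖ ≤
      C * √(r + ∑ i, T₂ i ^ 2) + ‖(closedLoop A B ubar T₁ T₂ K).f 0‖ := by
    intro s j hsj
    set x := φ.toFun s j with hx
    have h1 : ‖x‖ ≤ √(r + ∑ i, T₂ i ^ 2) := by
      rw [EuclideanSpace.norm_eq, Fintype.sum_sum_type]
      refine Real.sqrt_le_sqrt (add_le_add ?_ (Finset.sum_le_sum fun i _ => ?_))
      · refine le_trans (le_of_eq ?_) (hr s j hsj)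
        rw [Fintype.sum_sum_type]
        simp [← hx, dotProduct, State.plant, State.err, sq]
      · have h2 := hτ s j hsj i
        rw [Real.norm_eq_abs, sq_abs]
        exact pow_le_pow_left₀ h2.1 h2.2 2
    have h3 := hC.dist_le_mul x 0
    rw [dist_eq_norm, dist_zero_right] at h3
    have h4 := norm_le_norm_add_norm_sub' ((closedLoop A B ubar T₁ T₂ K).f x)
      ((closedLoop A B ubar T₁ T₂ K).f 0)
    have h5 := mul_le_mul_of_nonneg_left h1 C.coe_nonneg
    linarith
  refine hφ.isComplete hC.continuous (isClosed_timer_mem_timerSet T₂) hG hbound ?_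
  intro s j hsj hD
  have hpos : ∀ i, 0 < (φ.toFun s j).timer i := fun i =>
    lt_of_le_of_ne (hτ s j hsj i).1 fun h => hD ⟨i, hτ s j hsj, h.symm⟩
  obtain ⟨δ, hδ, hδle⟩ : ∃ δ > 0, ∀ i, δ ≤ (φ.toFun s j).timer i := by
    rcases isEmpty_or_nonempty (Fin q) with he | hne
    · exact ⟨1, one_pos, fun i => he.elim i⟩
    · obtain ⟨i, hi⟩ := Finite.exists_min (φ.toFun s j).timer
      exact ⟨_, hpos i, hi⟩
  obtain ⟨T, hT, y, hy0, hy⟩ := exists_flow_of_lipschitzWith hC (φ.toFun s j) s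
  refine ⟨min T (s + δ), lt_min hT (by linarith), y, hy0, fun r hr => ⟨?_, fun i => ?_⟩⟩
  · exact (hy r ⟨hr.1, hr.2.trans (min_le_left _ _)⟩).mono (Icc_subset_Icc_right (min_le_left _ _))
  · have h1 := timer_eq_sub hr.1 (fun u hu => (hy u ⟨hu.1, hu.2.trans
      (hr.2.trans (min_le_left _ _))⟩).mono (Icc_subset_Icc_right (hr.2.trans (min_le_left _ _)))) i
    rw [h1, hy0]
    have h2 := hδle i
    have h3 := (hτ s j hsj i).2
    have h4 := hr.2.trans (min_le_right _ _)
    have h5 := hr.1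
    constructor <;> linarith

end Invariants

end MultiRateSat

/-! ### Exponential stability and the basin of attraction -/

theorem proposition2 {q m : ℕ} {n : Fin q → ℕ}
    (A : Matrix (PlantIdx n) (PlantIdx n) ℝ) (B : Matrix (PlantIdx n) (Fin m) ℝ)
    (ubar : Fin m → ℝ) (hubar : ∀ i, 0 < ubar i)
    (T₁ T₂ : Fin q → ℝ) (hT₁ : ∀ i, 0 < T₁ i) (hT₁₂ : ∀ i, T₁ i ≤ T₂ i)
    (W : Matrix (PlantIdx n) (PlantIdx n) ℝ) (hW : W.PosDef)
    (Y Z : Matrix (Fin m) (PlantIdx n) ℝ)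
    (R : (i : Fin q) → Matrix (Fin (n i)) (Fin (n i)) ℝ) (hR : ∀ i, (R i).PosDef)
    (S : Matrix (Fin m) (Fin m) ℝ) (hSdiag : S.IsDiag) (hS : S.PosDef)
    (σ : Fin q → ℝ) (hσ : ∀ i, 0 < σ i)
    (μbar α : ℝ) (hμbar : 0 < μbar) (hα : 0 < α)
    (hincl : ∀ i : Fin m,
      (inclusionMatrix W (Matrix.blockDiagonal' R) (Z i) (ubar i ^ 2 / μbar)).PosSemidef)
    (hdes : ∀ Ψ ∈ vertices n σ T₂,
      (-designMatrix A B W (Matrix.blockDiagonal' R) (scalarBlocks n σ) Ψ Y Z S α).PosDef) :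
    ExponentiallyStable (closedLoop A B ubar T₁ T₂ (Y * W⁻¹)) (attractor n T₂) ∧
      basinEstimate T₂ W R σ μbar ⊆
        basin (closedLoop A B ubar T₁ T₂ (Y * W⁻¹)) (attractor n T₂) := by
  obtain ⟨c, hc, hdecay⟩ :=
    exists_lyapunov_decay A B hubar hW hR hSdiag hS hσ hμbar hincl hdes
  obtain ⟨a, ha, b, hb, hab⟩ := exists_lyapunov_bounds (T₂ := T₂) hσ hW hR
  set N : ℝ := ∑ i, T₂ i / T₁ i with hN
  set M : ℝ := ∑ i, 1 / T₁ i with hM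
  have hM0 : 0 ≤ M := Finset.sum_nonneg fun i _ => by have := hT₁ i; positivity
  -- `j ≤ N + M t` turns decay at the rate `c / 2` in `t` into decay at the rate `lam` in `t + j`
  set lam : ℝ := c / 2 / (1 + M) with hlam
  have hlam0 : 0 < lam := by positivity
  have hlamM : lam * (1 + M) = c / 2 := div_mul_cancel₀ _ (by positivity)
  set κ : ℝ := √(b / a) * Real.exp (lam * N) with hκ
  have hκ0 : 0 < κ := by positivity
  have key : ∀ φ : HybridArc (State n),
      IsMaximalSolution (closedLoop A B ubar T₁ T₂ (Y * W⁻¹)) φ →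
      lyapunov W R σ (φ.toFun 0 0).plant (φ.toFun 0 0).err (φ.toFun 0 0).timer ≤ μbar →
      IsComplete φ ∧ ∀ (t : ℝ) (j : ℕ), (t, j) ∈ φ.dom →
        Metric.infDist (φ.toFun t j) (attractor n T₂) ≤
          κ * Real.exp (-lam * (t + j)) * Metric.infDist (φ.toFun 0 0) (attractor n T₂) := by
    intro φ hφ h0
    have hinv := hφ.1.invariants hubar hT₁ hW hR hμbar hc hdecay h0
    have hτ0 := timer_zero_mem hφ.1
    set V₀ := lyapunov W R σ (φ.toFun 0 0).plant (φ.toFun 0 0).err (φ.toFun 0 0).timer with hV₀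
    have hV₀0 : 0 ≤ V₀ := lyapunov_nonneg hW hR _ _ _
    have hsq : ∀ t j, (t, j) ∈ φ.dom → (φ.toFun t j).plant ⬝ᵥ (φ.toFun t j).plant +
        (φ.toFun t j).err ⬝ᵥ (φ.toFun t j).err ≤ V₀ * Real.exp (-c * t) / a := by
      intro t j htj
      obtain ⟨hτ, hV, -, -⟩ := hinv j t htj
      rw [le_div_iff₀ ha, mul_comm]
      exact ((hab _ hτ _ _).1).trans hV
    refine ⟨hφ.isComplete_closedLoop (r := V₀ / a) hubar hT₁₂ (fun t j h => (hinv j t h).1)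
      fun t j h => (hsq t j h).trans ?_, fun t j h => ?_⟩
    · refine div_le_div_of_nonneg_right (mul_le_of_le_one_right hV₀0 ?_) ha.le
      exact Real.exp_le_one_iff.2 (by nlinarith [(hinv j t h).2.2.1])
    · obtain ⟨hτ, -, h0t, hj⟩ := hinv j t h
      rw [infDist_attractor hτ, infDist_attractor hτ0]
      set D := (φ.toFun 0 0).plant ⬝ᵥ (φ.toFun 0 0).plant +
        (φ.toFun 0 0).err ⬝ᵥ (φ.toFun 0 0).err with hD
      have hV₀D : V₀ ≤ b * D := (hab _ hτ0 _ _).2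
      have hjN : (j : ℝ) ≤ N + M * t := by
        refine hj.trans ?_
        rw [hN, hM, Finset.sum_mul, ← Finset.sum_add_distrib]
        refine Finset.sum_le_sum fun i _ => ?_
        rw [add_div, one_div_mul_eq_div]
        have := hT₁ i
        gcongr
        exact (hτ i).2
      have hexp : Real.exp (-c * t / 2) ≤ Real.exp (lam * N) * Real.exp (-lam * (t + j)) := by
        rw [← Real.exp_add, Real.exp_le_exp]
        have h1 := mul_le_mul_of_nonneg_left hjN hlam0.le
        have h2 : lam * t * (1 + M) = c / 2 * t := by rw [← hlamM]; ring
        nlinarith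
      have hsqrt : √(Real.exp (-c * t)) = Real.exp (-c * t / 2) := by
        rw [Real.exp_half]
      calc √((φ.toFun t j).plant ⬝ᵥ (φ.toFun t j).plant +
            (φ.toFun t j).err ⬝ᵥ (φ.toFun t j).err)
          ≤ √(b / a * Real.exp (-c * t) * D) := by
            refine Real.sqrt_le_sqrt ((hsq t j h).trans ?_)
            rw [div_mul_eq_mul_div, div_mul_eq_mul_div]
            refine div_le_div_of_nonneg_right ?_ ha.le
            rw [mul_right_comm]
            exact mul_le_mul_of_nonneg_right hV₀D (Real.exp_pos _).le
        _ = √(b / a) * Real.exp (-c * t / 2) * √D := by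
            rw [Real.sqrt_mul (by positivity), Real.sqrt_mul (by positivity), hsqrt]
        _ ≤ √(b / a) * (Real.exp (lam * N) * Real.exp (-lam * (t + j))) * √D := by gcongr
        _ = κ * Real.exp (-lam * (t + j)) * √D := by rw [hκ]; ring
  refine ⟨⟨κ, lam, √(μbar / b), hκ0, hlam0, by positivity, fun φ hφ h0 => key φ hφ ?_⟩, ?_⟩
  · have hτ0 := timer_zero_mem hφ.1
    rw [infDist_attractor hτ0, Real.sqrt_le_sqrt_iff (by positivity), le_div_iff₀ hb, mul_comm] at h0
    exact ((hab _ hτ0 _ _).2).trans h0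
  · rintro ξ ⟨-, hξ⟩ φ hφ rfl
    rw [dotProduct_Phat_mulVec] at hξ
    obtain ⟨hcompl, hest⟩ := key φ hφ hξ
    refine ⟨hcompl, fun ε hε => ?_⟩
    set D := Metric.infDist (φ.toFun 0 0) (attractor n T₂) with hD
    have hlim : Filter.Tendsto (fun s : ℝ => κ * Real.exp (-lam * s) * D) Filter.atTop
        (nhds 0) := by
      have h1 : Filter.Tendsto (fun s : ℝ => -lam * s) Filter.atTop Filter.atBot :=
        Filter.tendsto_id.const_mul_atTop_of_neg (neg_neg_of_pos hlam0)
      simpa using ((Real.tendsto_exp_atBot.comp h1).const_mul κ).mul_const D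
    obtain ⟨s₀, hs₀⟩ := Filter.eventually_atTop.1 (hlim.eventually_lt_const hε)
    exact ⟨s₀, fun t j h hs => (hest t j h).trans_lt (hs₀ _ hs)⟩
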